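/- Conventions. A graph is a set $V\sqcup E$ with origin and reversal maps $x\mapsto x^-$, $x\mapsto\bar x$ such that $\bar{\bar x}=x$, $x^-\in V$ and $x=x^-\Leftrightarrow x=\bar x\Leftrightarrow x\in V$; put $x^+=(\bar x)^-$. Graph morphisms commute with both maps and may send edges to vertices; they are simplicial if they send edges to edges. A graph of groups $\mathfrak X$ is a graph with groups $G_x$ and homomorphisms $()^-\colon G_x\to G_{x^-}$, $\bar{()}\colon G_x\to G_{\bar x}$, with $G_x\to G_{\bar x}\to G_x$ the identity and both homomorphisms the identity when $x$ is a vertex. A graph of bisets ${}_{\mathfrak Y}\mathfrak B_{\mathfrak X}$ is a graph $\mathfrak B$ with graph morphisms $\lambda\colon\mathfrak B\to\mathfrak Y$, $\rho\colon\mathfrak B\to\mathfrak X$, with $G_{\lambda(z)}$-$G_{\rho(z)}$-bisets $B_z$ for $z\in\mathfrak B$, and with congruences $()^-\colon B_z\to B_{z^-}$, $\bar{()}\colon B_z\to B_{\bar z}$ over the homomorphisms of $\mathfrak Y$, $\mathfrak X$, subject to the same axioms. It is left-fibrant if $\rho$ is simplicial and, for every vertex $v\in\mathfrak B$ and every edge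 $e_0\in\mathfrak X$ with $e_0^-=\rho(v)$, the map $$\bigsqcup_{e\in\rho^{-1}(e_0),\ e^-=v}G_{\lambda(v)}\otimes_{G_{\lambda(e)}}B_e\to B_v,\qquad g\otimes b\mapsto g\,b^-$$ is an isomorphism of $G_{\lambda(v)}$-$G_{e_0}$-bisets. It is left-free if moreover every $B_z$, $z\in\mathfrak B$, is left-free, that is, isomorphic to $G_{\lambda(z)}\times S$ as a left $G_{\lambda(z)}$-set for some set $S$. A finite $1$-dimensional cover of a path connected space is a finite cover by path connected subspaces $(X_v)$ such that for every $u,v$ and every path component $X'$ of $X_u\cap X_v$ there are an open neighbourhood $\widetilde X'\supseteq X'$ and an $X_w\subseteq X'$ such that $X_w\hookrightarrow\widetilde X'$ is a homotopy equivalence, and such that $X_u\subseteq X_v\subseteq X_w$ implies $u=v$ or $v=w$. For a space that is not path connected the same is asked, with the neighbourhoods taken in its path components. Given basepoints $*_v\in X_v$ and paths $\gamma_{uv}$ in $X_v$ from $*_u$ to $*_v$ whenever $X_u\subsetneq X_v$, the cover defines a graph of groups: its vertices are the indices $v$, with $G_v=\pi_1(X_v,*_v)$; every strict inclusion $X_u\subsetneq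 X_v$ gives an edge from $u$ to $v$ and its reverse, with group $G_u$, mapping to $G_u$ by the identity and to $G_v$ by $\gamma\mapsto\gamma_{uv}^{-1}\#\gamma\#\gamma_{uv}$. Let $X,Y$ be path connected spaces, let $(Z,f,i)$ be a topological correspondence from $Y$ to $X$, i.e. a space $Z$ with continuous maps $f\colon Z\to X$ and $i\colon Z\to Y$, and let $(U_\alpha)$, $(V_\beta)$, $(W_\gamma)$ be finite $1$-dimensional covers of $X$, $Y$, $Z$, with choices of basepoints $*_\alpha$, $\dagger_\beta$, $\ddagger_\gamma$ and connecting paths $\ell$, $m$, $\kappa$; let $\mathfrak X,\mathfrak Y$ be the graphs of groups of $(U_\alpha)$, $(V_\beta)$. Assume that the covers are compatible with $f$ and $i$: there are maps of indices $\rho,\lambda$ with $f(W_\gamma)\subseteq U_{\rho(\gamma)}$ and $i(W_\gamma)\subseteq V_{\lambda(\gamma)}$, such that $W_{\gamma'}\subsetneq W_\gamma$ implies that $\rho(\gamma')=\rho(\gamma)$ or $U_{\rho(\gamma')}\subsetneq U_{\rho(\gamma)}$, and that $\lambda(\gamma')=\lambda(\gamma)$ or $V_{\lambda(\gamma')}\subsetneq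 V_{\lambda(\gamma)}$. The graph of bisets ${}_{\mathfrak Y}\mathfrak B_{\mathfrak X}$ of $(Z,f,i)$ has as underlying graph the graph of the cover $(W_\gamma)$, with the graph morphisms induced by $\lambda$ and $\rho$. At a vertex $\gamma$ its biset is $B_\gamma=B(i|_{W_\gamma})^\vee\otimes_{\pi_1(W_\gamma,\ddagger_\gamma)}B(f|_{W_\gamma})$, where $B(f|_{W_\gamma})$ is the set of homotopy classes rel endpoints of paths in $U_{\rho(\gamma)}$ from $f(\ddagger_\gamma)$ to $*_{\rho(\gamma)}$, with $[\mu]\cdot[c]\cdot[\nu]=[f(\mu)\#c\#\nu]$, where $B(i|_{W_\gamma})$ is defined likewise with $V_{\lambda(\gamma)}$ and $\dagger_{\lambda(\gamma)}$, and where $B^\vee$ is $B$ with $g\cdot\check b\cdot h=(h^{-1}bg^{-1})\check{\ }$. At both edges of $W_{\gamma'}\subsetneq W_\gamma$ the biset is $B_{\gamma'}$; its map to $B_{\gamma'}$ is the identity, and its map to $B_\gamma$ is $\check b\otimes c\mapsto (i(\kappa)^{-1}\#b\#m)\check{\ }\otimes (f(\kappa)^{-1}\#c\#\ell)$, with $\kappa$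 the path from $\ddagger_{\gamma'}$ to $\ddagger_\gamma$, and $\ell$, $m$ those from $*_{\rho(\gamma')}$ to $*_{\rho(\gamma)}$ and from $\dagger_{\lambda(\gamma')}$ to $\dagger_{\lambda(\gamma)}$ (constant if the indices agree). Proposition. Suppose that $(W_\gamma)=f^*(U_\alpha)$, that is, for every $\alpha$ the $W_\gamma$ with $\rho(\gamma)=\alpha$ are exactly the path components of $f^{-1}(U_\alpha)$. If $f$ is a fibration (it has the homotopy lifting property with respect to all spaces), then ${}_{\mathfrak Y}\mathfrak B_{\mathfrak X}$ is a left-fibrant graph of bisets. If $f$ is a covering, then ${}_{\mathfrak Y}\mathfrak B_{\mathfrak X}$ is a left-free graph of bisets. -/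

import Mathlib

open Set Topology unitInterval

universe u v w u₁ u₂ u₃ u₄ u₅ u₆ u₇

noncomputable section

namespace BisetGraphs

/-! ### Bisets

An `H`-`G`-biset is a type `B` with `[MulAction H B] [MulAction Gᵐᵒᵖ B] [SMulCommClass H Gᵐᵒᵖ B]`;
the right action is `b · g = MulOpposite.op g • b`. -/

/-- Left-free: isomorphic, as a left `H`-set, to `H × S` with `H` acting by left multiplication
on the first coordinate. -/
def LeftFree (H : Type u) (B : Type v) [Group H] [MulAction H B] : Prop :=
  ∃ (S : Type v) (φ : B ≃ H × S), ∀ (h : H) (b : B), φ (h • b) = (h * (φ b).1, (φ b).2)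

section Contragredient

/-- The contragredient of an `H`-`G`-biset `B`: the same set, with
`g · b̌ · h = (h⁻¹ · b · g⁻¹)̌`. -/
def Contra (B : Type u) : Type u := B

/-- The element `b̌` of the contragredient. -/
def Contra.mk {B : Type u} (b : B) : Contra B := b

/-- The element `b` underlying `b̌`. -/
def Contra.val {B : Type u} (b : Contra B) : B := b

instance Contra.instLeft (G : Type v) (B : Type u) [Group G] [MulAction Gᵐᵒᵖ B] :
    MulAction G (Contra B) where
  smul g b := Contra.mk (MulOpposite.op g⁻¹ • b.val)
  one_smul b := by
    change MulOpposite.op (1 : G)⁻¹ • b.val = b.val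
    simp
  mul_smul g g' b := by
    change MulOpposite.op (g * g')⁻¹ • b.val
      = MulOpposite.op g⁻¹ • MulOpposite.op g'⁻¹ • b.val
    rw [mul_inv_rev, MulOpposite.op_mul, mul_smul]

instance Contra.instRight (H : Type v) (B : Type u) [Group H] [MulAction H B] :
    MulAction Hᵐᵒᵖ (Contra B) where
  smul h b := Contra.mk (h.unop⁻¹ • b.val)
  one_smul b := by
    change (1 : H)⁻¹ • b.val = b.val
    simp
  mul_smul g g' b := by
    change (g'.unop * g.unop)⁻¹ • b.val = g.unop⁻¹ • g'.unop⁻¹ • b.val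
    rw [mul_inv_rev, mul_smul]

theorem Contra.smul_def {G : Type v} {B : Type u} [Group G] [MulAction Gᵐᵒᵖ B] (g : G) (b : B) :
    g • Contra.mk b = Contra.mk (MulOpposite.op g⁻¹ • b) := rfl

theorem Contra.op_smul_def {H : Type v} {B : Type u} [Group H] [MulAction H B] (h : H) (b : B) :
    MulOpposite.op h • Contra.mk b = Contra.mk (h⁻¹ • b) := rfl

instance Contra.instComm (H : Type v) (G : Type w) (B : Type u) [Group H] [Group G]
    [MulAction H B] [MulAction Gᵐᵒᵖ B] [SMulCommClass H Gᵐᵒᵖ B] :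
    SMulCommClass G Hᵐᵒᵖ (Contra B) where
  smul_comm g h b := by
    change MulOpposite.op g⁻¹ • h.unop⁻¹ • b.val = h.unop⁻¹ • MulOpposite.op g⁻¹ • b.val
    exact (smul_comm _ _ _).symm

end Contragredient

section Tensor

/-- The relation `(b · k, c) = (b, k · c)` defining the product of bisets. -/
inductive TensorRel (K : Type u) (B : Type v) (C : Type w) [Group K] [MulAction Kᵐᵒᵖ B]
    [MulAction K C] : B × C → B × C → Prop
  | mk (b : B) (k : K) (c : C) : TensorRel K B C (MulOpposite.op k • b, c) (b, k • c)

/-- The product `B ⊗_K C` of bisets. -/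
def Tensor (K : Type u) (B : Type v) (C : Type w) [Group K] [MulAction Kᵐᵒᵖ B]
    [MulAction K C] : Type (max v w) :=
  Quot (TensorRel K B C)

variable {K : Type u} {B : Type v} {C : Type w} [Group K] [MulAction Kᵐᵒᵖ B] [MulAction K C]

/-- The pure tensor `b ⊗ c`. -/
def Tensor.mk (b : B) (c : C) : Tensor K B C := Quot.mk _ (b, c)

theorem Tensor.balanced (b : B) (k : K) (c : C) :
    (Tensor.mk (MulOpposite.op k • b) c : Tensor K B C) = Tensor.mk b (k • c) :=
  Quot.sound (TensorRel.mk b k c)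

theorem Tensor.ind {P : Tensor K B C → Prop} (h : ∀ b c, P (Tensor.mk b c)) (t) : P t := by
  obtain ⟨b, c⟩ := t
  exact h b c

/-- Maps out of `B ⊗_K C` are the balanced maps on `B × C`. -/
def Tensor.lift {D : Type u₁} (F : B → C → D)
    (hF : ∀ b (k : K) c, F (MulOpposite.op k • b) c = F b (k • c)) : Tensor K B C → D :=
  Quot.lift (fun p => F p.1 p.2) (by rintro _ _ ⟨b, k, c⟩; exact hF b k c)

instance Tensor.instLeft (H : Type u₁) [Group H] [MulAction H B] [SMulCommClass H Kᵐᵒᵖ B] :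
    MulAction H (Tensor K B C) where
  smul h := Tensor.lift (fun b c => Tensor.mk (h • b) c)
    (fun b k c => by rw [smul_comm, Tensor.balanced])
  one_smul t := by
    induction t using Tensor.ind with | h b c => exact congrArg (Tensor.mk · c) (one_smul H b)
  mul_smul g h t := by
    induction t using Tensor.ind with | h b c => exact congrArg (Tensor.mk · c) (mul_smul g h b)

instance Tensor.instRight (G : Type u₁) [Group G] [MulAction Gᵐᵒᵖ C] [SMulCommClass K Gᵐᵒᵖ C] :
    MulAction Gᵐᵒᵖ (Tensor K B C) where
  smul g := Tensor.lift (fun b c => Tensor.mk b (g • c))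
    (fun b k c => by rw [Tensor.balanced, smul_comm])
  one_smul t := by
    induction t using Tensor.ind with | h b c => exact congrArg (Tensor.mk b ·) (one_smul Gᵐᵒᵖ c)
  mul_smul g h t := by
    induction t using Tensor.ind with | h b c => exact congrArg (Tensor.mk b ·) (mul_smul g h c)

theorem Tensor.smul_mk {H : Type u₁} [Group H] [MulAction H B] [SMulCommClass H Kᵐᵒᵖ B]
    (h : H) (b : B) (c : C) :
    h • (Tensor.mk b c : Tensor K B C) = Tensor.mk (h • b) c := rfl

theorem Tensor.op_smul_mk {G : Type u₁} [Group G] [MulAction Gᵐᵒᵖ C] [SMulCommClass K Gᵐᵒᵖ C]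
    (g : Gᵐᵒᵖ) (b : B) (c : C) :
    g • (Tensor.mk b c : Tensor K B C) = Tensor.mk b (g • c) := rfl

instance Tensor.instComm (H : Type u₁) (G : Type u₂) [Group H] [MulAction H B]
    [SMulCommClass H Kᵐᵒᵖ B] [Group G] [MulAction Gᵐᵒᵖ C] [SMulCommClass K Gᵐᵒᵖ C] :
    SMulCommClass H Gᵐᵒᵖ (Tensor K B C) where
  smul_comm h g t := by
    induction t using Tensor.ind with | h b c => rfl

end Tensor

section ViaHom

/-- For `φ : K → H`, the group `H` as an `H`-`K`-biset: `H` acts by left multiplication and `K`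
acts on the right through `φ`. -/
def ViaHom {K : Type u} {H : Type v} [Group K] [Group H] (_φ : K →* H) : Type v := H

variable {K : Type u} {H : Type v} [Group K] [Group H] (φ : K →* H)

/-- An element of `H`, viewed in the biset `ViaHom φ`. -/
def ViaHom.mk (h : H) : ViaHom φ := h

instance ViaHom.instLeft : MulAction H (ViaHom φ) := inferInstanceAs (MulAction H H)

instance ViaHom.instRight : MulAction Kᵐᵒᵖ (ViaHom φ) where
  smul k h := ViaHom.mk φ (@id H h * φ k.unop)
  one_smul h := by
    change @id H h * φ 1 = @id H h
    simp
  mul_smul k l h := by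
    change @id H h * φ (l.unop * k.unop) = @id H h * φ l.unop * φ k.unop
    rw [map_mul, mul_assoc]

instance ViaHom.instComm : SMulCommClass H Kᵐᵒᵖ (ViaHom φ) where
  smul_comm g k h := by
    change g * (@id H h * φ k.unop) = (g * @id H h) * φ k.unop
    rw [mul_assoc]

end ViaHom

/-! ### Graphs, graphs of groups, graphs of bisets -/

/-- A graph: a set of objects `V ⊔ E` with origin `x ↦ x⁻` and reversal `x ↦ x̄`.
The edges are the objects that are not vertices. -/
structure Graph where
  Obj : Type u
  IsVertex : Obj → Prop
  orig : Obj → Obj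
  rev : Obj → Obj
  rev_rev : ∀ x, rev (rev x) = x
  orig_isVertex : ∀ x, IsVertex (orig x)
  eq_orig_iff : ∀ x, x = orig x ↔ x = rev x
  eq_rev_iff : ∀ x, x = rev x ↔ IsVertex x

/-- Graph morphisms; they may send edges to vertices. -/
structure GraphHom (A : Graph.{u}) (B : Graph.{v}) where
  toFun : A.Obj → B.Obj
  map_rev : ∀ x, toFun (A.rev x) = B.rev (toFun x)
  map_orig : ∀ x, toFun (A.orig x) = B.orig (toFun x)

/-- A graph morphism is simplicial if it sends edges to edges. -/
def GraphHom.IsSimplicial {A : Graph.{u}} {B : Graph.{v}} (θ : GraphHom A B) : Prop :=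
  ∀ x, ¬ A.IsVertex x → ¬ B.IsVertex (θ.toFun x)

/-- Graphs of groups. (Connectedness of the graph is not made part of the structure.) -/
structure GraphOfGroups extends Graph.{u} where
  G : Obj → Type v
  [grp : ∀ x, Group (G x)]
  minus : ∀ x, G x →* G (orig x)
  bar : ∀ x, G x →* G (rev x)
  bar_bar : ∀ x g, bar (rev x) (bar x g) ≍ g
  minus_vertex : ∀ x, IsVertex x → ∀ g, minus x g ≍ g
  bar_vertex : ∀ x, IsVertex x → ∀ g, bar x g ≍ g

attribute [instance] GraphOfGroups.grp

/-- Transport of group elements along an equality of objects. -/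
def GraphOfGroups.castHom (X : GraphOfGroups.{u, v}) {x y : X.Obj} (h : x = y) :
    X.G x →* X.G y := h ▸ MonoidHom.id (X.G x)

/-- A graph of bisets between the graphs of groups `Y` (acting on the left) and `X` (acting on
the right). The maps `minus` and `bar` are congruences; `castHom` only transports along
`λ(z)⁻ = λ(z⁻)` and its analogues. -/
structure GraphOfBisets (Y : GraphOfGroups.{u₁, u₂}) (X : GraphOfGroups.{u₃, u₄})
    extends Graph.{u₅} where
  lam : GraphHom toGraph Y.toGraph
  rho : GraphHom toGraph X.toGraph
  B : Obj → Type u₆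
  [left : ∀ z, MulAction (Y.G (lam.toFun z)) (B z)]
  [right : ∀ z, MulAction (X.G (rho.toFun z))ᵐᵒᵖ (B z)]
  [comm : ∀ z, SMulCommClass (Y.G (lam.toFun z)) (X.G (rho.toFun z))ᵐᵒᵖ (B z)]
  minus : ∀ z, B z → B (orig z)
  bar : ∀ z, B z → B (rev z)
  minus_left : ∀ z (h : Y.G (lam.toFun z)) (b : B z),
    minus z (h • b) = Y.castHom (lam.map_orig z).symm (Y.minus _ h) • minus z b
  minus_right : ∀ z (g : X.G (rho.toFun z)) (b : B z),
    minus z (MulOpposite.op g • b)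
      = MulOpposite.op (X.castHom (rho.map_orig z).symm (X.minus _ g)) • minus z b
  bar_left : ∀ z (h : Y.G (lam.toFun z)) (b : B z),
    bar z (h • b) = Y.castHom (lam.map_rev z).symm (Y.bar _ h) • bar z b
  bar_right : ∀ z (g : X.G (rho.toFun z)) (b : B z),
    bar z (MulOpposite.op g • b)
      = MulOpposite.op (X.castHom (rho.map_rev z).symm (X.bar _ g)) • bar z b
  bar_bar : ∀ z b, bar (rev z) (bar z b) ≍ b
  minus_vertex : ∀ z, IsVertex z → ∀ b, minus z b ≍ b
  bar_vertex : ∀ z, IsVertex z → ∀ b, bar z b ≍ b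

attribute [instance] GraphOfBisets.left GraphOfBisets.right GraphOfBisets.comm

namespace GraphOfBisets

variable {Y : GraphOfGroups.{u₁, u₂}} {X : GraphOfGroups.{u₃, u₄}}
  (𝔅 : GraphOfBisets.{u₁, u₂, u₃, u₄, u₅, u₆} Y X)

/-- For `e⁻ = v`, the homomorphism `()⁻ : G_{λ(e)} → G_{λ(v)}`. -/
def leftHom {e v : 𝔅.Obj} (he : 𝔅.orig e = v) :
    Y.G (𝔅.lam.toFun e) →* Y.G (𝔅.lam.toFun v) :=
  (Y.castHom ((𝔅.lam.map_orig e).symm.trans (congrArg 𝔅.lam.toFun he))).comp (Y.minus _)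

/-- For `e⁻ = v`, the homomorphism `()⁻ : G_{ρ(e)} → G_{ρ(v)}`. -/
def rightHom {e v : 𝔅.Obj} (he : 𝔅.orig e = v) :
    X.G (𝔅.rho.toFun e) →* X.G (𝔅.rho.toFun v) :=
  (X.castHom ((𝔅.rho.map_orig e).symm.trans (congrArg 𝔅.rho.toFun he))).comp (X.minus _)

/-- For `e⁻ = v`, the congruence `()⁻ : B_e → B_v`. -/
def minusTo {e v : 𝔅.Obj} (he : 𝔅.orig e = v) (b : 𝔅.B e) : 𝔅.B v := he ▸ 𝔅.minus e b

theorem minusTo_left {e v : 𝔅.Obj} (he : 𝔅.orig e = v) (h : Y.G (𝔅.lam.toFun e)) (b : 𝔅.B e) :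
    𝔅.minusTo he (h • b) = 𝔅.leftHom he h • 𝔅.minusTo he b := by
  subst he; exact 𝔅.minus_left e h b

theorem minusTo_right {e v : 𝔅.Obj} (he : 𝔅.orig e = v) (g : X.G (𝔅.rho.toFun e)) (b : 𝔅.B e) :
    𝔅.minusTo he (MulOpposite.op g • b)
      = MulOpposite.op (𝔅.rightHom he g) • 𝔅.minusTo he b := by
  subst he; exact 𝔅.minus_right e g b

/-- The map `G_{λ(v)} ⊗_{G_{λ(e)}} B_e → B_v`, `g ⊗ b ↦ g b⁻`, for `e⁻ = v`. -/
def edgeMap {e v : 𝔅.Obj} (he : 𝔅.orig e = v) :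
    Tensor (Y.G (𝔅.lam.toFun e)) (ViaHom (𝔅.leftHom he)) (𝔅.B e) → 𝔅.B v :=
  Tensor.lift (fun g b => (@id (Y.G (𝔅.lam.toFun v)) g) • 𝔅.minusTo he b) (fun g k b => by
    change (@id (Y.G (𝔅.lam.toFun v)) g * 𝔅.leftHom he k) • 𝔅.minusTo he b = _
    rw [mul_smul, minusTo_left])

/-- `edgeMap` is a morphism of left `G_{λ(v)}`-sets. -/
theorem edgeMap_left {e v : 𝔅.Obj} (he : 𝔅.orig e = v) (h : Y.G (𝔅.lam.toFun v))
    (t : Tensor (Y.G (𝔅.lam.toFun e)) (ViaHom (𝔅.leftHom he)) (𝔅.B e)) :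
    𝔅.edgeMap he (h • t) = h • 𝔅.edgeMap he t := by
  induction t using Tensor.ind with
  | h g b => exact mul_smul h (@id (Y.G (𝔅.lam.toFun v)) g) (𝔅.minusTo he b)

/-- `edgeMap` is a morphism of right `G_{ρ(e)}`-sets, for the action on `B_v` through `()⁻`. -/
theorem edgeMap_right {e v : 𝔅.Obj} (he : 𝔅.orig e = v) (g : X.G (𝔅.rho.toFun e))
    (t : Tensor (Y.G (𝔅.lam.toFun e)) (ViaHom (𝔅.leftHom he)) (𝔅.B e)) :
    𝔅.edgeMap he (MulOpposite.op g • t)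
      = MulOpposite.op (𝔅.rightHom he g) • 𝔅.edgeMap he t := by
  induction t using Tensor.ind with
  | h a b =>
    change (@id (Y.G (𝔅.lam.toFun v)) a) • 𝔅.minusTo he (MulOpposite.op g • b) = _
    rw [minusTo_right, smul_comm]
    rfl

/-- The disjoint union of the bisets `G_{λ(v)} ⊗_{G_{λ(e)}} B_e` over all `e ∈ ρ⁻¹(x)` with
`e⁻ = v`. -/
def EdgeUnion (v : 𝔅.Obj) (x : X.Obj) : Type (max u₂ u₅ u₆) :=
  Σ e : {e : 𝔅.Obj // 𝔅.rho.toFun e = x ∧ 𝔅.orig e = v},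
    Tensor (Y.G (𝔅.lam.toFun e.1)) (ViaHom (𝔅.leftHom e.2.2)) (𝔅.B e.1)

/-- The map `⨆_e G_{λ(v)} ⊗_{G_{λ(e)}} B_e → B_v`, `g ⊗ b ↦ g b⁻`. -/
def unionMap (v : 𝔅.Obj) (x : X.Obj) : 𝔅.EdgeUnion v x → 𝔅.B v :=
  fun t => 𝔅.edgeMap t.1.2.2 t.2

/-- Left-fibrant graphs of bisets. The map `unionMap` respects the actions of `G_{λ(v)}` and `G_x`
(`edgeMap_left`, `edgeMap_right`), so it is an isomorphism of bisets iff it is bijective. -/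
def IsLeftFibrant : Prop :=
  𝔅.rho.IsSimplicial ∧
    ∀ v : 𝔅.Obj, 𝔅.IsVertex v → ∀ x : X.Obj, ¬ X.IsVertex x → X.orig x = 𝔅.rho.toFun v →
      Function.Bijective (𝔅.unionMap v x)

/-- Left-free (or covering) graphs of bisets. -/
def IsLeftFree : Prop :=
  𝔅.IsLeftFibrant ∧ ∀ z : 𝔅.Obj, LeftFree (Y.G (𝔅.lam.toFun z)) (𝔅.B z)

end GraphOfBisets

/-! ### Fundamental groups and bisets of continuous maps -/

/-- Homotopy classes, relative to the endpoints, of paths from `a` to `b`. -/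
abbrev PC {A : Type u} [TopologicalSpace A] (a b : A) := Path.Homotopic.Quotient a b

/-- The fundamental group, with the product `[λ][μ] = [λ # μ]` (first `λ`, then `μ`). -/
abbrev Pi1 {A : Type u} [TopologicalSpace A] (a : A) : Type u := PC a a

instance {A : Type u} [TopologicalSpace A] (a : A) : Group (Pi1 a) where
  mul p q := Path.Homotopic.Quotient.trans p q
  one := Path.Homotopic.Quotient.refl a
  inv p := Path.Homotopic.Quotient.symm p
  mul_assoc p q r := Path.Homotopic.Quotient.trans_assoc p q r
  one_mul p := Path.Homotopic.Quotient.refl_trans p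
  mul_one p := Path.Homotopic.Quotient.trans_refl p
  inv_mul_cancel p := Path.Homotopic.Quotient.symm_trans p

section MapBiset

variable {A : Type u} {B : Type v} [TopologicalSpace A] [TopologicalSpace B]

theorem map_trans {a b c : A} (p : PC a b) (q : PC b c) (φ : C(A, B)) :
    (p.trans q).map φ = (p.map φ).trans (q.map φ) := by
  rcases p with ⟨p⟩
  rcases q with ⟨q⟩
  exact congrArg Path.Homotopic.Quotient.mk (p.map_trans q φ.continuous)

theorem map_symm {a b : A} (p : PC a b) (φ : C(A, B)) : p.symm.map φ = (p.map φ).symm := by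
  rcases p with ⟨p⟩
  rfl

/-- The biset `B(φ, a, b)` of a continuous map: classes of paths in the target from `φ(a)`
to `b`. -/
def MapBiset (φ : C(A, B)) (a : A) (b : B) : Type v := PC (φ a) b

/-- `[λ] · [γ] = [φ ∘ λ # γ]`. -/
instance (φ : C(A, B)) (a : A) (b : B) : MulAction (Pi1 a) (MapBiset φ a b) where
  smul l c := Path.Homotopic.Quotient.trans (Path.Homotopic.Quotient.map l φ) c
  one_smul c := Path.Homotopic.Quotient.refl_trans c
  mul_smul l m c := by
    exact (congrArg (Path.Homotopic.Quotient.trans · c) (map_trans l m φ)).trans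
      (Path.Homotopic.Quotient.trans_assoc (Path.Homotopic.Quotient.map l φ)
        (Path.Homotopic.Quotient.map m φ) c)

/-- `[γ] · [μ] = [γ # μ]`. -/
instance (φ : C(A, B)) (a : A) (b : B) : MulAction (Pi1 b)ᵐᵒᵖ (MapBiset φ a b) where
  smul m c := Path.Homotopic.Quotient.trans c m.unop
  one_smul c := Path.Homotopic.Quotient.trans_refl c
  mul_smul l m c := (Path.Homotopic.Quotient.trans_assoc c m.unop l.unop).symm

instance (φ : C(A, B)) (a : A) (b : B) :
    SMulCommClass (Pi1 a) (Pi1 b)ᵐᵒᵖ (MapBiset φ a b) where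
  smul_comm l m c :=
    (Path.Homotopic.Quotient.trans_assoc (Path.Homotopic.Quotient.map l φ) c m.unop).symm

/-- For a map `j : A → B` and (the class of) a path `k` from `j(a)` to `b`, the homomorphism
`π₁(A, a) → π₁(B, b)`, `γ ↦ k⁻¹ # j(γ) # k`. -/
def conjHom (j : C(A, B)) {a : A} {b : B} (k : PC (j a) b) : Pi1 a →* Pi1 b where
  toFun g := k.symm.trans ((Path.Homotopic.Quotient.map g j).trans k)
  map_one' := by
    change k.symm.trans ((Path.Homotopic.Quotient.refl (j a)).trans k)
      = Path.Homotopic.Quotient.refl b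
    simp
  map_mul' g h := by
    change k.symm.trans (((Path.Homotopic.Quotient.trans g h).map j).trans k)
      = (k.symm.trans ((Path.Homotopic.Quotient.map g j).trans k)).trans
          (k.symm.trans ((Path.Homotopic.Quotient.map h j).trans k))
    rw [map_trans]
    simp only [Path.Homotopic.Quotient.trans_assoc]
    rw [← Path.Homotopic.Quotient.trans_assoc k k.symm, Path.Homotopic.Quotient.trans_symm,
      Path.Homotopic.Quotient.refl_trans]

end MapBiset

section Subspaces

variable {X : Type u} {Z : Type v} [TopologicalSpace X] [TopologicalSpace Z]

/-- The map `f : W → U` between subspaces induced by `f`. -/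
def restr (f : C(Z, X)) {W : Set Z} {U : Set X} (h : MapsTo f W U) : C(W, U) :=
  ⟨h.restrict f W U, f.continuous.continuousOn.mapsToRestrict h⟩

/-- For `W ⊆ W'` and `U ⊆ U'` with `f(W) ⊆ U`, `f(W') ⊆ U'`, and paths `κ` in `W'` from `a` to
`a'` and `ℓ` in `U'` from `b` to `b'`, the map `B(f : W → U, a, b) → B(f : W' → U', a', b')`,
`c ↦ f(κ)⁻¹ # c # ℓ`. -/
def push (f : C(Z, X)) {W W' : Set Z} {U U' : Set X} (h : MapsTo f W U) (h' : MapsTo f W' U')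
    (hW : W ⊆ W') (hU : U ⊆ U') {a : W} {a' : W'} {b : U} {b' : U'}
    (κ : PC (ContinuousMap.inclusion hW a) a') (ℓ : PC (ContinuousMap.inclusion hU b) b')
    (c : MapBiset (restr f h) a b) : MapBiset (restr f h') a' b' :=
  (κ.map (restr f h')).symm.trans
    (((Path.Homotopic.Quotient.map c (ContinuousMap.inclusion hU)).cast rfl rfl).trans ℓ)

theorem push_left (f : C(Z, X)) {W W' : Set Z} {U U' : Set X} (h : MapsTo f W U)
    (h' : MapsTo f W' U') (hW : W ⊆ W') (hU : U ⊆ U') {a : W} {a' : W'} {b : U} {b' : U'}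
    (κ : PC (ContinuousMap.inclusion hW a) a') (ℓ : PC (ContinuousMap.inclusion hU b) b')
    (g : Pi1 a) (c : MapBiset (restr f h) a b) :
    push f h h' hW hU κ ℓ (g • c)
      = conjHom (ContinuousMap.inclusion hW) κ g • push f h h' hW hU κ ℓ c := by
  let c₀ : PC (restr f h' (ContinuousMap.inclusion hW a)) (ContinuousMap.inclusion hU b) :=
    (Path.Homotopic.Quotient.map c (ContinuousMap.inclusion hU)).cast rfl rfl
  have key : (Path.Homotopic.Quotient.map (g • c : MapBiset (restr f h) a b)
      (ContinuousMap.inclusion hU)).cast rfl rfl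
        = ((Path.Homotopic.Quotient.map g (ContinuousMap.inclusion hW)).map (restr f h')).trans
          c₀ := by
    rcases g with ⟨g⟩
    rcases c with ⟨c⟩
    exact congrArg Path.Homotopic.Quotient.mk
      (Path.map_trans (g.map (restr f h).continuous) c (ContinuousMap.inclusion hU).continuous)
  have hR : ((conjHom (ContinuousMap.inclusion hW) κ g).map (restr f h')).trans
        ((κ.map (restr f h')).symm.trans (c₀.trans ℓ))
      = (κ.map (restr f h')).symm.trans
        ((((Path.Homotopic.Quotient.map g (ContinuousMap.inclusion hW)).map
          (restr f h')).trans c₀).trans ℓ) := by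
    change (Path.Homotopic.Quotient.map (κ.symm.trans
      ((Path.Homotopic.Quotient.map g (ContinuousMap.inclusion hW)).trans κ)) _).trans _ = _
    rw [map_trans, map_trans, map_symm]
    simp only [Path.Homotopic.Quotient.trans_assoc]
    rw [← Path.Homotopic.Quotient.trans_assoc (κ.map (restr f h')),
      Path.Homotopic.Quotient.trans_symm, Path.Homotopic.Quotient.refl_trans]
  exact (congrArg (fun t => (κ.map (restr f h')).symm.trans (Path.Homotopic.Quotient.trans t ℓ))
    key).trans hR.symm

theorem push_right (f : C(Z, X)) {W W' : Set Z} {U U' : Set X} (h : MapsTo f W U)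
    (h' : MapsTo f W' U') (hW : W ⊆ W') (hU : U ⊆ U') {a : W} {a' : W'} {b : U} {b' : U'}
    (κ : PC (ContinuousMap.inclusion hW a) a') (ℓ : PC (ContinuousMap.inclusion hU b) b')
    (g : Pi1 b) (c : MapBiset (restr f h) a b) :
    push f h h' hW hU κ ℓ (MulOpposite.op g • c)
      = MulOpposite.op (conjHom (ContinuousMap.inclusion hU) ℓ g) • push f h h' hW hU κ ℓ c := by
  let c₀ : PC (restr f h' (ContinuousMap.inclusion hW a)) (ContinuousMap.inclusion hU b) :=
    (Path.Homotopic.Quotient.map c (ContinuousMap.inclusion hU)).cast rfl rfl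
  have key : (Path.Homotopic.Quotient.map (MulOpposite.op g • c : MapBiset (restr f h) a b)
      (ContinuousMap.inclusion hU)).cast rfl rfl
        = c₀.trans (Path.Homotopic.Quotient.map g (ContinuousMap.inclusion hU)) := by
    rcases g with ⟨g⟩
    rcases c with ⟨c⟩
    exact congrArg Path.Homotopic.Quotient.mk
      (Path.map_trans c g (ContinuousMap.inclusion hU).continuous)
  have hR : ((κ.map (restr f h')).symm.trans (c₀.trans ℓ)).trans
        (conjHom (ContinuousMap.inclusion hU) ℓ g)
      = (κ.map (restr f h')).symm.trans ((c₀.trans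
        (Path.Homotopic.Quotient.map g (ContinuousMap.inclusion hU))).trans ℓ) := by
    change Path.Homotopic.Quotient.trans _ (ℓ.symm.trans
      ((Path.Homotopic.Quotient.map g (ContinuousMap.inclusion hU)).trans ℓ)) = _
    simp only [Path.Homotopic.Quotient.trans_assoc]
    rw [← Path.Homotopic.Quotient.trans_assoc ℓ ℓ.symm,
      Path.Homotopic.Quotient.trans_symm, Path.Homotopic.Quotient.refl_trans]
  exact (congrArg (fun t => (κ.map (restr f h')).symm.trans (Path.Homotopic.Quotient.trans t ℓ))
    key).trans hR.symm

end Subspaces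

/-! ### Correspondences -/

section Correspondence

variable {X : Type u} {Y : Type v} {Z : Type w}
  [TopologicalSpace X] [TopologicalSpace Y] [TopologicalSpace Z]

/-- The biset `B(i)^∨ ⊗ B(f)` of the correspondence `V ← W → U` given by the restrictions of `i`
and `f`, where the product is over `π₁(W, a)`. -/
abbrev CorrBiset (f : C(Z, X)) (i : C(Z, Y)) {W : Set Z} {U : Set X} {V : Set Y}
    (hf : MapsTo f W U) (hi : MapsTo i W V) (a : W) (p : V) (b : U) : Type (max u v) :=
  Tensor (Pi1 a) (Contra (MapBiset (restr i hi) a p)) (MapBiset (restr f hf) a b)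

variable (f : C(Z, X)) (i : C(Z, Y)) {W W' : Set Z} {U U' : Set X} {V V' : Set Y}
    (hf : MapsTo f W U) (hi : MapsTo i W V) (hf' : MapsTo f W' U') (hi' : MapsTo i W' V')
    (hW : W ⊆ W') (hU : U ⊆ U') (hV : V ⊆ V') {a : W} {a' : W'} {b : U} {b' : U'} {p : V} {p' : V'}
    (κ : PC (ContinuousMap.inclusion hW a) a') (ℓ : PC (ContinuousMap.inclusion hU b) b')
    (m : PC (ContinuousMap.inclusion hV p) p')

/-- The product of the congruences `push` for `i` (on contragredients) and for `f`. -/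
def corrPush : CorrBiset f i hf hi a p b → CorrBiset f i hf' hi' a' p' b' :=
  Tensor.lift
    (fun β c => Tensor.mk (Contra.mk (push i hi hi' hW hV κ m β.val)) (push f hf hf' hW hU κ ℓ c))
    (fun β k c => by
      rw [push_left, ← Tensor.balanced, Contra.op_smul_def, ← map_inv, ← push_left]
      rfl)

theorem corrPush_left (h : Pi1 p) (t : CorrBiset f i hf hi a p b) :
    corrPush f i hf hi hf' hi' hW hU hV κ ℓ m (h • t)
      = conjHom (ContinuousMap.inclusion hV) m h •
        corrPush f i hf hi hf' hi' hW hU hV κ ℓ m t := by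
  induction t using Tensor.ind with
  | h β c =>
    change Tensor.mk (Contra.mk (push i hi hi' hW hV κ m (MulOpposite.op h⁻¹ • β.val))) _
      = Tensor.mk (Contra.mk (MulOpposite.op (conjHom (ContinuousMap.inclusion hV) m h)⁻¹ •
          push i hi hi' hW hV κ m β.val)) _
    rw [push_right, map_inv]

theorem corrPush_right (g : Pi1 b) (t : CorrBiset f i hf hi a p b) :
    corrPush f i hf hi hf' hi' hW hU hV κ ℓ m (MulOpposite.op g • t)
      = MulOpposite.op (conjHom (ContinuousMap.inclusion hU) ℓ g) •
        corrPush f i hf hi hf' hi' hW hU hV κ ℓ m t := by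
  induction t using Tensor.ind with
  | h β c =>
    change Tensor.mk _ (push f hf hf' hW hU κ ℓ (MulOpposite.op g • c)) = Tensor.mk _ _
    rw [push_right]

end Correspondence

/-! ### Covers and their graphs of groups -/

/-- Finite 1-dimensional covers. For a space which is not path connected the neighbourhoods `O`
are taken in the path component that contains the piece under consideration, as when the
definition is applied to each path component separately. -/
structure IsFiniteOneDimCover {X : Type u} [TopologicalSpace X] {J : Type u₁} (U : J → Set X) :
    Prop where
  finite : Finite J
  isPathConnected : ∀ a, IsPathConnected (U a)
  iUnion_eq : ⋃ a, U a = univ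
  inter : ∀ a b, ∀ x ∈ U a ∩ U b, ∃ O : Set X,
    (∃ O' : Set X, IsOpen O' ∧ O = O' ∩ pathComponent x) ∧
    pathComponentIn (U a ∩ U b) x ⊆ O ∧
    ∃ c, U c ⊆ pathComponentIn (U a ∩ U b) x ∧
      ∃ (h : U c ⊆ O) (e : ContinuousMap.HomotopyEquiv (U c) O),
        e.toFun = ContinuousMap.inclusion h
  dim : ∀ a b c, U a ⊆ U b → U b ⊆ U c → a = b ∨ b = c

/-- Choices of basepoints in the pieces of a cover, and of connecting paths. -/
structure Marking {X : Type u} [TopologicalSpace X] {J : Type u₁} (U : J → Set X) where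
  pt : ∀ a, U a
  conn : ∀ a b (h : U a ⊂ U b), Path (Set.inclusion h.subset (pt a)) (pt b)

/-- The order on the index set of a cover: equality or strict inclusion of the pieces. -/
def CoverLE {X : Type u} {J : Type u₁} (U : J → Set X) (a b : J) : Prop := a = b ∨ U a ⊂ U b

theorem CoverLE.subset {X : Type u} {J : Type u₁} {U : J → Set X} {a b : J}
    (h : CoverLE U a b) : U a ⊆ U b := by
  rcases h with rfl | h
  exacts [Subset.rfl, h.subset]

/-- The class of the connecting path from the basepoint of `U a` to that of `U b`; it is constant
if `a = b`. -/
def Marking.link {X : Type u} [TopologicalSpace X] {J : Type u₁} {U : J → Set X} (M : Marking U)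
    {a b : J} (h : CoverLE U a b) :
    PC (ContinuousMap.inclusion h.subset (M.pt a)) (M.pt b) :=
  open Classical in
  if e : a = b then (Path.Homotopic.Quotient.refl (M.pt b)).cast (by subst e; rfl) rfl
  else Path.Homotopic.Quotient.mk (M.conn a b (h.resolve_left e))

/-- For `U a ⊆ U b`, the homomorphism `π₁(U a) → π₁(U b)`, `γ ↦ ℓ⁻¹ # γ # ℓ` with `ℓ` the
connecting path. -/
def Marking.trans {X : Type u} [TopologicalSpace X] {J : Type u₁} {U : J → Set X} (M : Marking U)
    {a b : J} (h : CoverLE U a b) : Pi1 (M.pt a) →* Pi1 (M.pt b) :=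
  conjHom (ContinuousMap.inclusion h.subset) (M.link h)

/-- The objects of the graph of a cover: a vertex for every piece, and for every strict inclusion
`U a ⊂ U b` an edge `up` from `a` to `b` together with its reverse `down`, from `b` to `a`. -/
inductive CoverObj {X : Type u} {J : Type u₁} (U : J → Set X) : Type u₁
  | vert (a : J) : CoverObj U
  | up (a b : J) (h : U a ⊂ U b) : CoverObj U
  | down (a b : J) (h : U a ⊂ U b) : CoverObj U

namespace CoverObj

variable {X : Type u} {J : Type u₁} {U : J → Set X}

/-- The index of the smaller of the two ends of an object. -/
def base : CoverObj U → J
  | vert a => a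
  | up a _ _ => a
  | down a _ _ => a

/-- The object from `a` to `b`: an edge, or a vertex if `a = b`. -/
def upObj (a b : J) (h : CoverLE U a b) : CoverObj U :=
  open Classical in if e : a = b then vert a else up a b (h.resolve_left e)

/-- The object from `b` to `a`: an edge, or a vertex if `a = b`. -/
def downObj (a b : J) (h : CoverLE U a b) : CoverObj U :=
  open Classical in if e : a = b then vert a else down a b (h.resolve_left e)

theorem upObj_self (a : J) (h : CoverLE U a a) : upObj a a h = vert a := dif_pos rfl

theorem downObj_self (a : J) (h : CoverLE U a a) : downObj a a h = vert a := dif_pos rfl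

theorem ne_of_ssubset {a b : J} (h : U a ⊂ U b) : a ≠ b := by
  rintro rfl
  exact ssubset_irrefl _ h

theorem upObj_of_ssubset (a b : J) (h : U a ⊂ U b) : upObj a b (Or.inr h) = up a b h :=
  dif_neg (ne_of_ssubset h)

theorem downObj_of_ssubset (a b : J) (h : U a ⊂ U b) : downObj a b (Or.inr h) = down a b h :=
  dif_neg (ne_of_ssubset h)

end CoverObj

open CoverObj in
/-- The graph of a cover. -/
def coverGraph {X : Type u} {J : Type u₁} (U : J → Set X) : Graph.{u₁} where
  Obj := CoverObj U
  IsVertex x := ∃ a, x = vert a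
  orig
    | vert a => vert a
    | up a _ _ => vert a
    | down _ b _ => vert b
  rev
    | vert a => vert a
    | up a b h => down a b h
    | down a b h => up a b h
  rev_rev x := by cases x <;> rfl
  orig_isVertex x := by cases x <;> exact ⟨_, rfl⟩
  eq_orig_iff x := by cases x <;> simp
  eq_rev_iff x := by cases x <;> simp

open CoverObj in
/-- The graph of groups of a cover: `G_a = π₁(U a)` at the vertex `a`, and `G_e = π₁(U a)` at the
two edges between `a` and `b` with `U a ⊂ U b`. The homomorphism to the group of the smaller end is
the identity, that to the group of the larger end is `γ ↦ ℓ⁻¹ # γ # ℓ`. -/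
def Marking.graphOfGroups {X : Type u} [TopologicalSpace X] {J : Type u₁} {U : J → Set X}
    (M : Marking U) : GraphOfGroups.{u₁, u} where
  toGraph := coverGraph U
  G x := Pi1 (M.pt (base x))
  minus
    | vert a => MonoidHom.id (Pi1 (M.pt a))
    | up a _ _ => MonoidHom.id (Pi1 (M.pt a))
    | down _ _ h => M.trans (Or.inr h)
  bar
    | vert a => MonoidHom.id (Pi1 (M.pt a))
    | up a _ _ => MonoidHom.id (Pi1 (M.pt a))
    | down a _ _ => MonoidHom.id (Pi1 (M.pt a))
  bar_bar x g := by cases x <;> rfl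
  minus_vertex := by rintro _ ⟨a, rfl⟩ g; rfl
  bar_vertex := by rintro _ ⟨a, rfl⟩ g; rfl

/-- Transport of elements of `π₁(U a)` along an equality of indices. -/
def Marking.castHom {X : Type u} [TopologicalSpace X] {J : Type u₁} {U : J → Set X}
    (M : Marking U) {a b : J} (h : a = b) : Pi1 (M.pt a) →* Pi1 (M.pt b) :=
  h ▸ MonoidHom.id (Pi1 (M.pt a))

/-- Compatibility of covers `W` of `Z` and `U` of `X` with a map `f : Z → X`: every `W c` is sent
into `U (r c)`, where `r` is compatible with the inclusions between the pieces, so that it extends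
to a morphism of graphs. -/
structure Compatible {X : Type u} {Z : Type w} {J : Type u₁} {K : Type u₃} (f : Z → X)
    (W : K → Set Z) (U : J → Set X) (r : K → J) : Prop where
  mapsTo : ∀ c, MapsTo f (W c) (U (r c))
  mono : ∀ c d, W c ⊂ W d → CoverLE U (r c) (r d)

theorem Compatible.le {X : Type u} {Z : Type w} {J : Type u₁} {K : Type u₃} {f : Z → X}
    {W : K → Set Z} {U : J → Set X} {r : K → J} (hr : Compatible f W U r) {c d : K}
    (h : CoverLE W c d) : CoverLE U (r c) (r d) := by
  rcases h with rfl | h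
  exacts [Or.inl rfl, hr.mono _ _ h]

open CoverObj in
/-- The morphism of graphs given by a compatible map of indices: the edge of `W c ⊂ W d` goes to
the edge of `U (r c) ⊂ U (r d)`, or to the vertex `r c` if `r c = r d`. -/
def Compatible.graphHom {X : Type u} {Z : Type w} {J : Type u₁} {K : Type u₃} {f : Z → X}
    {W : K → Set Z} {U : J → Set X} {r : K → J} (hr : Compatible f W U r) :
    GraphHom (coverGraph W) (coverGraph U) where
  toFun
    | vert c => vert (r c)
    | up c d h => upObj (r c) (r d) (hr.mono c d h)
    | down c d h => downObj (r c) (r d) (hr.mono c d h)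
  map_rev x := by
    cases x with
    | vert c => rfl
    | up c d h =>
      change downObj (r c) (r d) _ = (coverGraph U).rev (upObj (r c) (r d) _)
      unfold downObj upObj
      split_ifs <;> rfl
    | down c d h =>
      change upObj (r c) (r d) _ = (coverGraph U).rev (downObj (r c) (r d) _)
      unfold downObj upObj
      split_ifs <;> rfl
  map_orig x := by
    cases x with
    | vert c => rfl
    | up c d h =>
      change vert (r c) = (coverGraph U).orig (upObj (r c) (r d) _)
      unfold upObj
      split_ifs <;> rfl
    | down c d h =>
      change vert (r d) = (coverGraph U).orig (downObj (r c) (r d) _)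
      unfold downObj
      split_ifs with e
      · rw [← e]; rfl
      · rfl

open CoverObj in
theorem Compatible.base_graphHom {X : Type u} {Z : Type w} {J : Type u₁} {K : Type u₃} {f : Z → X}
    {W : K → Set Z} {U : J → Set X} {r : K → J} (hr : Compatible f W U r) (x : CoverObj W) :
    base (U := U) (hr.graphHom.toFun x) = r (base x) := by
  cases x with
  | vert c => rfl
  | up c d h =>
    change base (upObj (r c) (r d) (hr.mono c d h)) = r c
    unfold upObj
    split_ifs <;> rfl
  | down c d h =>
    change base (downObj (r c) (r d) (hr.mono c d h)) = r c
    unfold downObj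
    split_ifs <;> rfl

section CastLemmas

open CoverObj

variable {X : Type u} [TopologicalSpace X] {J : Type u₁} {U : J → Set X} (M : Marking U)

theorem Marking.trans_self {a : J} (h : CoverLE U a a) (g : Pi1 (M.pt a)) : M.trans h g = g := by
  have hl : M.link h = Path.Homotopic.Quotient.refl (M.pt a) := by
    unfold Marking.link
    rw [dif_pos rfl]
    exact Path.Homotopic.Quotient.cast_rfl_rfl _
  have hi : Path.Homotopic.Quotient.map g (ContinuousMap.inclusion h.subset) = g := by
    rcases g with ⟨g⟩
    rfl
  change (M.link h).symm.trans ((Path.Homotopic.Quotient.map g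
    (ContinuousMap.inclusion h.subset)).trans (M.link h)) = g
  rw [hl, hi]
  exact (Path.Homotopic.Quotient.refl_trans _).trans (Path.Homotopic.Quotient.trans_refl _)

theorem Marking.castHom_heq {a b : J} (h : a = b) (g : Pi1 (M.pt a)) : M.castHom h g ≍ g := by
  subst h; rfl

theorem GraphOfGroups.castHom_heq (Y : GraphOfGroups.{u, v}) {x y : Y.Obj} (h : x = y)
    (g : Y.G x) : Y.castHom h g ≍ g := by
  subst h; rfl

theorem Marking.bar_heq (x : CoverObj U) (g : M.graphOfGroups.G x) :
    M.graphOfGroups.bar x g ≍ g := by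
  cases x <;> rfl

theorem Marking.minus_upObj_heq {a b : J} (h : CoverLE U a b) (x : CoverObj U)
    (hx : x = upObj a b h) (g : M.graphOfGroups.G x) : M.graphOfGroups.minus x g ≍ g := by
  rcases h with rfl | h
  · replace hx := hx.trans (upObj_self a (Or.inl rfl)); subst hx; rfl
  · replace hx := hx.trans (upObj_of_ssubset a b h); subst hx; rfl

theorem Marking.minus_downObj_heq {a b : J} (h : CoverLE U a b) (x : CoverObj U)
    (hx : x = downObj a b h) (hb : base x = a) (g : M.graphOfGroups.G x) :
    M.graphOfGroups.minus x g ≍ M.trans h (M.castHom hb g) := by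
  rcases h with rfl | h
  · replace hx := hx.trans (downObj_self a (Or.inl rfl)); subst hx
    exact heq_of_eq (M.trans_self (Or.inl rfl) g).symm
  · replace hx := hx.trans (downObj_of_ssubset a b h); subst hx; rfl

variable {Z : Type w} {K : Type u₃} {f : Z → X} {W : K → Set Z} {r : K → J}

/-- `Compatible.graphHom`, with values in the graph underlying the graph of groups. -/
def Compatible.gHom (hr : Compatible f W U r) :
    GraphHom (coverGraph W) M.graphOfGroups.toGraph := hr.graphHom

/-- The homomorphism by which the group of an object of `coverGraph U` that lies below an object
`x` of `coverGraph W` acts on bisets over `W (base x)`: a mere transport along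
`base (θ x) = r (base x)`. -/
def Compatible.actHom (hr : Compatible f W U r) (x : (coverGraph W).Obj) :
    M.graphOfGroups.G ((hr.gHom M).toFun x) →* Pi1 (M.pt (r (base x))) :=
  M.castHom (hr.base_graphHom x)

theorem Compatible.actHom_heq (hr : Compatible f W U r) (x : (coverGraph W).Obj)
    (g : M.graphOfGroups.G ((hr.gHom M).toFun x)) : hr.actHom M x g ≍ g :=
  M.castHom_heq _ g

theorem Compatible.actHom_vert (hr : Compatible f W U r) (c : K) (g : Pi1 (M.pt (r c))) :
    hr.actHom M (vert c) g = g := rfl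

theorem Compatible.actHom_bar (hr : Compatible f W U r) (x : (coverGraph W).Obj)
    (g : M.graphOfGroups.G ((hr.gHom M).toFun x)) :
    hr.actHom M ((coverGraph W).rev x) (M.graphOfGroups.castHom ((hr.gHom M).map_rev x).symm
      (M.graphOfGroups.bar _ g)) ≍ hr.actHom M x g :=
  (hr.actHom_heq M _ _).trans ((GraphOfGroups.castHom_heq _ _ _).trans
    ((M.bar_heq _ g).trans (hr.actHom_heq M x g).symm))

theorem Compatible.actHom_minus_up (hr : Compatible f W U r) (c d : K) (h : W c ⊂ W d)
    (g : M.graphOfGroups.G ((hr.gHom M).toFun (up c d h))) :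
    hr.actHom M (vert c) (M.graphOfGroups.castHom ((hr.gHom M).map_orig (up c d h)).symm
      (M.graphOfGroups.minus _ g)) = hr.actHom M (up c d h) g :=
  eq_of_heq ((hr.actHom_heq M (vert c) _).trans ((GraphOfGroups.castHom_heq _ _ _).trans
    ((M.minus_upObj_heq (hr.mono c d h) _ rfl g).trans (hr.actHom_heq M _ g).symm)))

theorem Compatible.actHom_minus_down (hr : Compatible f W U r) (c d : K) (h : W c ⊂ W d)
    (g : M.graphOfGroups.G ((hr.gHom M).toFun (down c d h))) :
    hr.actHom M (vert d) (M.graphOfGroups.castHom ((hr.gHom M).map_orig (down c d h)).symm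
      (M.graphOfGroups.minus _ g)) = M.trans (hr.mono c d h) (hr.actHom M (down c d h) g) :=
  eq_of_heq ((hr.actHom_heq M (vert d) _).trans ((GraphOfGroups.castHom_heq _ _ _).trans
    (M.minus_downObj_heq (hr.mono c d h) _ rfl _ g)))

end CastLemmas

/-! ### The graph of bisets of a correspondence -/

section CorrGraph

open CoverObj

variable {X : Type u} {Y : Type v} {Z : Type w}
  [TopologicalSpace X] [TopologicalSpace Y] [TopologicalSpace Z] (f : C(Z, X)) (i : C(Z, Y))
  {J : Type u₁} {L : Type u₂} {K : Type u₃} {U : J → Set X} {V : L → Set Y} {W : K → Set Z}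
  (MU : Marking U) (MV : Marking V) (MW : Marking W) {ρ : K → J} {lam : K → L}
  (hρ : Compatible f W U ρ) (hl : Compatible i W V lam)

/-- The biset `B(f : W c → U (ρ c), i : W c → V (λ c))`. -/
abbrev PieceBiset (c : K) : Type (max u v) :=
  CorrBiset f i (hρ.mapsTo c) (hl.mapsTo c) (MW.pt c) (MV.pt (lam c)) (MU.pt (ρ c))

/-- The biset at an object `x`: at a vertex the biset of the piece, at an edge between `c` and
`d`, where `W c ⊂ W d`, the biset of `c`. -/
def ObjBiset (x : (coverGraph W).Obj) : Type (max u v) := PieceBiset f i MU MV MW hρ hl (base x)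

instance (x : (coverGraph W).Obj) : MulAction (MV.graphOfGroups.G ((hl.gHom MV).toFun x))
    (ObjBiset f i MU MV MW hρ hl x) :=
  MulAction.compHom (PieceBiset f i MU MV MW hρ hl (base x)) (hl.actHom MV x)

instance (x : (coverGraph W).Obj) : MulAction (MU.graphOfGroups.G ((hρ.gHom MU).toFun x))ᵐᵒᵖ
    (ObjBiset f i MU MV MW hρ hl x) :=
  MulAction.compHom (PieceBiset f i MU MV MW hρ hl (base x)) (hρ.actHom MU x).op

instance (x : (coverGraph W).Obj) : SMulCommClass (MV.graphOfGroups.G ((hl.gHom MV).toFun x))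
    (MU.graphOfGroups.G ((hρ.gHom MU).toFun x))ᵐᵒᵖ (ObjBiset f i MU MV MW hρ hl x) where
  smul_comm h g b := smul_comm (hl.actHom MV x h) ((hρ.actHom MU x).op g)
    (show PieceBiset f i MU MV MW hρ hl (base x) from b)

/-- The congruence `B_c → B_d` for `W c ⊂ W d`, given by the connecting paths. -/
def pieceMap {c d : K} (h : W c ⊂ W d) :
    PieceBiset f i MU MV MW hρ hl c → PieceBiset f i MU MV MW hρ hl d :=
  corrPush f i (hρ.mapsTo c) (hl.mapsTo c) (hρ.mapsTo d) (hl.mapsTo d)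
    h.subset (hρ.mono c d h).subset (hl.mono c d h).subset
    (MW.link (Or.inr h)) (MU.link (hρ.mono c d h)) (MV.link (hl.mono c d h))

theorem pieceMap_left {c d : K} (hcd : W c ⊂ W d) (h : Pi1 (MV.pt (lam c)))
    (b : PieceBiset f i MU MV MW hρ hl c) :
    pieceMap f i MU MV MW hρ hl hcd (h • b)
      = MV.trans (hl.mono c d hcd) h • pieceMap f i MU MV MW hρ hl hcd b :=
  corrPush_left f i _ _ _ _ _ _ _ _ _ _ h b

theorem pieceMap_right {c d : K} (hcd : W c ⊂ W d) (g : Pi1 (MU.pt (ρ c)))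
    (b : PieceBiset f i MU MV MW hρ hl c) :
    pieceMap f i MU MV MW hρ hl hcd (MulOpposite.op g • b)
      = MulOpposite.op (MU.trans (hρ.mono c d hcd) g) • pieceMap f i MU MV MW hρ hl hcd b :=
  corrPush_right f i _ _ _ _ _ _ _ _ _ _ g b

/-- The map `()⁻`: the identity at vertices and at edges starting at their smaller end, and
`pieceMap` at edges starting at their larger end. -/
def objMinus : ∀ x : (coverGraph W).Obj,
    ObjBiset f i MU MV MW hρ hl x → ObjBiset f i MU MV MW hρ hl ((coverGraph W).orig x)
  | vert _ => id
  | up _ _ _ => id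
  | down _ _ h => pieceMap f i MU MV MW hρ hl h

/-- The map `b ↦ b̄`, which is the identity. -/
def objBar : ∀ x : (coverGraph W).Obj,
    ObjBiset f i MU MV MW hρ hl x → ObjBiset f i MU MV MW hρ hl ((coverGraph W).rev x)
  | vert _ => id
  | up _ _ _ => id
  | down _ _ _ => id

/-- The graph of bisets of the correspondence `(Z, f, i)` with respect to covers `U`, `V`, `W` of
`X`, `Y`, `Z`. -/
def corrGraphOfBisets : GraphOfBisets.{u₂, v, u₁, u, u₃, max u v} MV.graphOfGroups
    MU.graphOfGroups where
  toGraph := coverGraph W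
  lam := hl.gHom MV
  rho := hρ.gHom MU
  B := ObjBiset f i MU MV MW hρ hl
  left _ := inferInstance
  right _ := inferInstance
  comm _ := inferInstance
  minus := objMinus f i MU MV MW hρ hl
  bar := objBar f i MU MV MW hρ hl
  minus_left z h b := by
    cases z with
    | vert c => rfl
    | up c d hcd =>
      have e := hl.actHom_minus_up MV c d hcd h
      exact (congrArg (fun g : Pi1 (MV.pt (lam c)) =>
        g • (id b : PieceBiset f i MU MV MW hρ hl c)) e).symm
    | down c d hcd =>
      have e := hl.actHom_minus_down MV c d hcd h
      exact (pieceMap_left f i MU MV MW hρ hl hcd (hl.actHom MV (down c d hcd) h) b).trans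
        (congrArg (fun g : Pi1 (MV.pt (lam d)) =>
          g • pieceMap f i MU MV MW hρ hl hcd b) e).symm
  minus_right z g b := by
    cases z with
    | vert c => rfl
    | up c d hcd =>
      have e := hρ.actHom_minus_up MU c d hcd g
      exact (congrArg (fun g : Pi1 (MU.pt (ρ c)) =>
        MulOpposite.op g • (id b : PieceBiset f i MU MV MW hρ hl c)) e).symm
    | down c d hcd =>
      have e := hρ.actHom_minus_down MU c d hcd g
      exact (pieceMap_right f i MU MV MW hρ hl hcd (hρ.actHom MU (down c d hcd) g) b).trans
        (congrArg (fun g : Pi1 (MU.pt (ρ d)) =>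
          MulOpposite.op g • pieceMap f i MU MV MW hρ hl hcd b) e).symm
  bar_left z h b := by
    cases z with
    | vert c => rfl
    | up c d hcd =>
      have e := eq_of_heq (hl.actHom_bar MV (up c d hcd) h)
      exact (congrArg (fun g : Pi1 (MV.pt (lam c)) =>
        g • (id b : PieceBiset f i MU MV MW hρ hl c)) e).symm
    | down c d hcd =>
      have e := eq_of_heq (hl.actHom_bar MV (down c d hcd) h)
      exact (congrArg (fun g : Pi1 (MV.pt (lam c)) =>
        g • (id b : PieceBiset f i MU MV MW hρ hl c)) e).symm
  bar_right z g b := by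
    cases z with
    | vert c => rfl
    | up c d hcd =>
      have e := eq_of_heq (hρ.actHom_bar MU (up c d hcd) g)
      exact (congrArg (fun g : Pi1 (MU.pt (ρ c)) =>
        MulOpposite.op g • (id b : PieceBiset f i MU MV MW hρ hl c)) e).symm
    | down c d hcd =>
      have e := eq_of_heq (hρ.actHom_bar MU (down c d hcd) g)
      exact (congrArg (fun g : Pi1 (MU.pt (ρ c)) =>
        MulOpposite.op g • (id b : PieceBiset f i MU MV MW hρ hl c)) e).symm
  bar_bar z b := by cases z <;> rfl
  minus_vertex := by rintro _ ⟨c, rfl⟩ b; rfl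
  bar_vertex := by rintro _ ⟨c, rfl⟩ b; rfl

end CorrGraph

/-! ### Fibrations and pullback covers -/

/-- Fibrations: maps with the homotopy lifting property with respect to all spaces. (The test
spaces range over a universe containing the mapping path space of `f`; lifting for spaces in any
other universe follows from this.) -/
def IsFibration {Z : Type w} {X : Type u} [TopologicalSpace Z] [TopologicalSpace X]
    (f : C(Z, X)) : Prop :=
  ∀ (A : Type (max u w)) [TopologicalSpace A] (g : C(A × I, X)) (h : C(A, Z)),
    (∀ a, f (h a) = g (a, 0)) →
    ∃ G : C(A × I, Z), (∀ a, G (a, 0) = h a) ∧ ∀ p, f (G p) = g p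

/-- `W`, with the map of indices `ρ`, is the pullback `f^*(U)`: the pieces `W c` with `ρ c = a`
are exactly the path components of `f⁻¹(U a)`. -/
def IsPullbackCover {X : Type u} {Z : Type w} [TopologicalSpace Z] {J : Type u₁} {K : Type u₃}
    (f : Z → X) (U : J → Set X) (W : K → Set Z) (ρ : K → J) : Prop :=
  (∀ c, ∃ z ∈ f ⁻¹' U (ρ c), W c = pathComponentIn (f ⁻¹' U (ρ c)) z) ∧
    ∀ a, ∀ z ∈ f ⁻¹' U a, ∃ c, ρ c = a ∧ W c = pathComponentIn (f ⁻¹' U a) z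

end BisetGraphs

/-! Fix a piece `W c` and an edge of the graph of `U` starting at `ρ c`.

If the edge goes up, to some `U b ⊃ U (ρ c)`, exactly one component of `f⁻¹(U b)` contains `W c`. So
exactly one edge at `c` lies over it, its biset is `B_c` with the identity as congruence, and the
map is `G ⊗ B = B` (`unionMap_up_bijective`).

If it goes down, to `U a ⊂ U (ρ c)`, path lifting sorts `B_c` by the components of `f⁻¹(U a)` inside
`W c`. For surjectivity, given `β̌ ⊗ γ`, lift `γ # ℓ⁻¹` to `W c` from its basepoint. The lift ends
over the basepoint of `U a`, hence in one such component `W c'`, and up to a loop in `W c`, which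
the tensor product absorbs, `γ` comes from `W c'` (`exists_smul_corrPush_eq`). For injectivity, two
elements with the same image yield a path in `W c` between their pieces. After lifts of the two
second factors are attached at its ends, its image in `U (ρ c)` is null-homotopic, so by homotopy
lifting it deforms into the fibre over the basepoint of `U a`
(`HasSquareLifting.exists_fibre_path`). That fibre lies in `f⁻¹(U a)`, so the pieces agree and the
path already exists in the smaller piece (`eq_of_raise_eq`, `exists_lift_of_raise_eq`). The first
factors cost nothing, because loops act simply transitively on the right of `B(i)`.

Only lifting of squares is used. For a covering, paths in a fibre are constant, so `π₁(W c) → π₁(U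
(ρ c))` is injective (`eq_one_of_smul_eq`). A stabilizer in `B_c` is then trivial, and a free action
is a union of regular orbits. -/

namespace BisetGraphs

/-! ### Path classes and constant paths -/

section PathClasses

open Path

variable {A : Type u} {B : Type v} [TopologicalSpace A] [TopologicalSpace B]

theorem symm_trans_cancel_left {a b c : A} (p : PC a b) (q : PC b c) :
    p.symm.trans (p.trans q) = q := by
  rw [← Homotopic.Quotient.trans_assoc, Homotopic.Quotient.symm_trans,
    Homotopic.Quotient.refl_trans]

theorem trans_symm_cancel_left {a b c : A} (p : PC a b) (q : PC a c) :
    p.trans (p.symm.trans q) = q := by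
  rw [← Homotopic.Quotient.trans_assoc, Homotopic.Quotient.trans_symm,
    Homotopic.Quotient.refl_trans]

theorem trans_symm_trans_cancel {a b c : A} (p : PC a c) (q : PC b c) :
    (p.trans q.symm).trans q = p := by
  rw [Homotopic.Quotient.trans_assoc, Homotopic.Quotient.symm_trans,
    Homotopic.Quotient.trans_refl]

theorem trans_left_cancel {a b c : A} (p : PC a b) {q q' : PC b c}
    (h : p.trans q = p.trans q') : q = q' := by
  rw [← symm_trans_cancel_left p q, h, symm_trans_cancel_left]

theorem trans_right_cancel {a b c : A} {p p' : PC a b} (q : PC b c)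
    (h : p.trans q = p'.trans q) : p = p' := by
  have := congrArg (Homotopic.Quotient.trans · q.symm) h
  simpa only [Homotopic.Quotient.trans_assoc, Homotopic.Quotient.trans_symm,
    Homotopic.Quotient.trans_refl] using this

/-- Classes of paths that are pointwise constant. -/
def IsConst {x b : A} (ν : PC x b) : Prop :=
  ∃ p : Path x b, Homotopic.Quotient.mk p = ν ∧ ∀ t, p t = b

/-- A lift ends over `b` only up to a propositional equality. Constant classes carry that equality
as a path, so that path classes need not be cast between endpoints. -/
theorem exists_isConst {x b : A} (h : x = b) : ∃ ν : PC x b, IsConst ν := by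
  subst h
  exact ⟨_, Path.refl x, rfl, fun _ => rfl⟩

theorem IsConst.eq {x b : A} {ν ν' : PC x b} (h : IsConst ν) (h' : IsConst ν') : ν = ν' := by
  obtain ⟨p, rfl, hp⟩ := h
  obtain ⟨q, rfl, hq⟩ := h'
  exact congrArg Homotopic.Quotient.mk (Path.ext (funext fun t => (hp t).trans (hq t).symm))

theorem IsConst.eq_refl {x : A} {ν : PC x x} (h : IsConst ν) : ν = Homotopic.Quotient.refl x :=
  h.eq ⟨Path.refl x, rfl, fun _ => rfl⟩

theorem IsConst.trans {x y b : A} {μ : PC x y} {ν : PC y b} (hμ : IsConst μ) (hν : IsConst ν) :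
    IsConst (μ.trans ν) := by
  obtain ⟨p, rfl, hp⟩ := hμ
  obtain ⟨q, rfl, hq⟩ := hν
  obtain rfl : y = b := by rw [← hq 0, q.source]
  refine ⟨p.trans q, rfl, fun t => ?_⟩
  rw [Path.trans_apply]
  split_ifs
  exacts [hp _, hq _]

/-- A path in a fibre maps to a constant path. -/
theorem IsConst.map_trans {e e' : A} {b : B} (q : C(A, B)) (τ : Path e e')
    (hτ : ∀ t, q (τ t) = b) {ν : PC (q e) b} {ν' : PC (q e') b} (hν : IsConst ν)
    (hν' : IsConst ν') : (Homotopic.Quotient.map (Homotopic.Quotient.mk τ) q).trans ν' = ν := by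
  refine IsConst.eq (IsConst.trans ⟨τ.map q.continuous, rfl, fun t => ?_⟩ hν') hν
  exact (hτ t).trans ((hτ 1).symm.trans (congrArg q τ.target))

end PathClasses

/-! ### Lifting of paths and of homotopies of paths -/

section SquareLifting

open Path

variable {E : Type u} {B : Type v} [TopologicalSpace E] [TopologicalSpace B]

/-- The homotopy lifting property with respect to the unit interval. -/
def HasSquareLifting (q : C(E, B)) : Prop :=
  ∀ (g : C(I × I, B)) (h : C(I, E)), (∀ s, q (h s) = g (s, 0)) →
    ∃ G : C(I × I, E), (∀ s, G (s, 0) = h s) ∧ ∀ p, q (G p) = g p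

/-- Path lifting is square lifting for a square that does not depend on its first coordinate; one
vertical side of the lifted square is the lift. -/
theorem HasSquareLifting.exists_lift {q : C(E, B)} (hq : HasSquareLifting q) {e : E} {b : B}
    (γ : PC (q e) b) : ∃ (e' : E) (γ' : PC e e') (ν : PC (q e') b), q e' = b ∧ IsConst ν ∧
      (Homotopic.Quotient.map γ' q).trans ν = γ := by
  rcases γ with ⟨γ⟩
  obtain ⟨G, hG, hqG⟩ := hq (γ.toContinuousMap.comp ContinuousMap.snd) (ContinuousMap.const I e)
    (fun s => γ.source.symm)
  have hb : q (G (0, 1)) = b := (hqG (0, 1)).trans γ.target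
  let γ' : Path e (G (0, 1)) :=
    { toFun := fun t => G (0, t)
      continuous_toFun := by fun_prop
      source' := hG 0
      target' := rfl }
  subst hb
  refine ⟨G (0, 1), Homotopic.Quotient.mk γ', Homotopic.Quotient.refl _, rfl,
    ⟨Path.refl _, rfl, fun _ => rfl⟩, ?_⟩
  rw [Homotopic.Quotient.trans_refl]
  exact congrArg Homotopic.Quotient.mk (Path.ext (funext fun t => hqG (0, t)))

theorem contractibleSpace_unitInterval : ContractibleSpace I :=
  (convex_Icc (0 : ℝ) 1).contractibleSpace ⟨0, by simp⟩

/-- Any two paths in the square with the same endpoints are homotopic. -/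
theorem square_paths_homotopic {x y : I × I} (p p' : Path x y) : p.Homotopic p' := by
  have := contractibleSpace_unitInterval
  exact SimplyConnectedSpace.paths_homotopic _ _

/-- The path from `(0, 0)` to `(1, 0)` along the other three sides of the square. -/
def squareDetour : Path ((0, 0) : I × I) (1, 0) :=
  let side (s : I) : Path ((s, 0) : I × I) (s, 1) :=
    { toFun := fun t => (s, t)
      continuous_toFun := by fun_prop
      source' := rfl
      target' := rfl }
  let top : Path ((0, 1) : I × I) (1, 1) :=
    { toFun := fun t => (t, 1)
      continuous_toFun := by fun_prop
      source' := rfl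
      target' := rfl }
  ((side 0).trans top).trans (side 1).symm

theorem squareDetour_mem (t : I) :
    (squareDetour t).1 = 0 ∨ (squareDetour t).2 = 1 ∨ (squareDetour t).1 = 1 := by
  unfold squareDetour
  simp only [Path.trans_apply]
  split_ifs
  · exact Or.inl rfl
  · exact Or.inr (Or.inl rfl)
  · exact Or.inr (Or.inr rfl)

/-- A path whose image in the base is homotopic to a constant path is homotopic to a path in
the fibre. -/
theorem HasSquareLifting.exists_fibre_path {q : C(E, B)} (hq : HasSquareLifting q) {e e' : E}
    {b : B} (ε : PC e e') {ν : PC (q e) b} {ν' : PC (q e') b} (hν : IsConst ν) (hν' : IsConst ν')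
    (h : (Homotopic.Quotient.map ε q).trans ν' = ν) :
    ∃ τ : Path e e', Homotopic.Quotient.mk τ = ε ∧ ∀ t, q (τ t) = b := by
  obtain ⟨n', rfl, hn'⟩ := hν'
  obtain rfl : q e' = b := by rw [← hn' 0, n'.source]
  have h1 : Homotopic.Quotient.mk n' = Homotopic.Quotient.refl (q e') :=
    IsConst.eq_refl ⟨n', rfl, hn'⟩
  obtain ⟨n, rfl, hn⟩ := hν
  rcases ε with ⟨ε⟩
  rw [h1, Homotopic.Quotient.trans_refl] at h
  obtain ⟨H⟩ := Homotopic.Quotient.exact (p := ε.map q.continuous) (q := n) h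
  -- The first coordinate becomes the parameter of `ε` and the second the time of `H`. The bottom
  -- side of `G` is then `ε`, and `H` has the constant value `b` on the other three sides: two
  -- because it fixes endpoints, the top because `n` is constant.
  obtain ⟨G, hG, hqG⟩ := hq (H.toContinuousMap.comp ContinuousMap.prodSwap) ε.toContinuousMap
    (fun s => (H.apply_zero s).symm)
  have hqG' : ∀ s t, q (G (s, t)) = H (t, s) := fun s t => hqG (s, t)
  have he : q e = q e' := by rw [← hn 0, n.source]
  have h0 : e = G (0, 0) := by rw [hG]; exact ε.source.symm
  have h2 : e' = G (1, 0) := by rw [hG]; exact ε.target.symm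
  refine ⟨(squareDetour.map G.continuous).cast h0 h2, ?_, fun t => ?_⟩
  · let bottom : Path ((0, 0) : I × I) (1, 0) :=
      { toFun := fun s => (s, 0)
        continuous_toFun := by fun_prop
        source' := rfl
        target' := rfl }
    -- The square is simply connected, so its bottom side deforms to the detour, which `G` sends
    -- into the fibre.
    have h3 : (squareDetour.map G.continuous).Homotopic (bottom.map G.continuous) :=
      (square_paths_homotopic squareDetour bottom).map G
    have h4 : (bottom.map G.continuous).cast h0 h2 = ε := Path.ext (funext fun s => hG s)
    have h5 := h3.pathCast h0 h2
    rw [h4] at h5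
    exact Homotopic.Quotient.eq.2 h5
  · change q (G (squareDetour t)) = q e'
    have hm := squareDetour_mem t
    rcases hx : squareDetour t with ⟨x, y⟩
    rw [hx] at hm
    rw [hqG']
    rcases hm with rfl | rfl | rfl
    · simp [he]
    · rw [H.apply_one]; exact hn x
    · simp

end SquareLifting

/-! ### Path classes in subspaces -/

section Raise

variable {X : Type u} {Z : Type v} [TopologicalSpace X] [TopologicalSpace Z] (f : C(Z, X))
  {W W' : Set Z} {U U' : Set X} (h : MapsTo f W U) (h' : MapsTo f W' U') (hW : W ⊆ W')
  (hU : U ⊆ U')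

open Path

/-- A class of paths in `U`, starting at the image of a point of `W`, viewed in `U'`. -/
def raise {a : W} {b : U} (c : PC (restr f h a) b) :
    PC (restr f h' (ContinuousMap.inclusion hW a)) (ContinuousMap.inclusion hU b) :=
  (Homotopic.Quotient.map c (ContinuousMap.inclusion hU)).cast rfl rfl

theorem raise_trans {a a₁ : W} {b : U} (g : PC a a₁) (c : PC (restr f h a₁) b) :
    raise f h h' hW hU ((Homotopic.Quotient.map g (restr f h)).trans c)
      = ((Homotopic.Quotient.map g (ContinuousMap.inclusion hW)).map (restr f h')).trans
        (raise f h h' hW hU c) := by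
  rcases g with ⟨g⟩
  rcases c with ⟨c⟩
  exact congrArg Homotopic.Quotient.mk
    (Path.map_trans (g.map (restr f h).continuous) c (ContinuousMap.inclusion hU).continuous)

theorem IsConst.raise {a : W} {b : U} {c : PC (restr f h a) b} (hc : IsConst c) :
    IsConst (raise f h h' hW hU c) := by
  obtain ⟨p, rfl, hp⟩ := hc
  exact ⟨p.map (ContinuousMap.inclusion hU).continuous, rfl,
    fun t => congrArg (ContinuousMap.inclusion hU) (hp t)⟩

/-- Two classes with the same image under `push`, up to a loop in `W'`, become equal in `U'` after
transport along a path in `W'`. -/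
theorem raise_eq_of_push_eq {W₂ : Set Z} (h₂ : MapsTo f W₂ U) (hW₂ : W₂ ⊆ W') {a : W} {a₂ : W₂}
    {a' : W'} {b : U} {b' : U'}
    (κ : PC (ContinuousMap.inclusion hW a) a') (κ₂ : PC (ContinuousMap.inclusion hW₂ a₂) a')
    (ℓ : PC (ContinuousMap.inclusion hU b) b') (c : MapBiset (restr f h) a b)
    (c₂ : MapBiset (restr f h₂) a₂ b) (δ : Pi1 a')
    (e : push f h h' hW hU κ ℓ c = δ • push f h₂ h' hW₂ hU κ₂ ℓ c₂) :
    (Homotopic.Quotient.map (κ.trans (δ.trans κ₂.symm)) (restr f h')).trans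
      (raise f h₂ h' hW₂ hU c₂) = raise f h h' hW hU c := by
  have e' : (Homotopic.Quotient.map κ (restr f h')).symm.trans ((raise f h h' hW hU c).trans ℓ)
      = (Homotopic.Quotient.map δ (restr f h')).trans
        ((Homotopic.Quotient.map κ₂ (restr f h')).symm.trans
          ((raise f h₂ h' hW₂ hU c₂).trans ℓ)) := e
  have e₂ := congrArg (Homotopic.Quotient.trans (Homotopic.Quotient.map κ (restr f h'))) e'
  rw [trans_symm_cancel_left] at e₂
  apply trans_right_cancel ℓ
  rw [e₂, BisetGraphs.map_trans, BisetGraphs.map_trans, map_symm]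
  simp only [Homotopic.Quotient.trans_assoc]

/-- If paths `γ₁`, `γ₂` in `U` become equal in `U'` after transport along a path in `W'`, then that
path is homotopic to a lift of `γ₁`, followed by a path in a fibre, followed by the inverse of a
lift of `γ₂`. -/
theorem exists_fibre_path_of_raise_eq {W₁ W₂ : Set Z} {h₁ : MapsTo f W₁ U} {h₂ : MapsTo f W₂ U}
    {hW₁ : W₁ ⊆ W'} {hW₂ : W₂ ⊆ W'} (q₁ : HasSquareLifting (restr f h₁))
    (q₂ : HasSquareLifting (restr f h₂)) (q' : HasSquareLifting (restr f h'))
    {z₁ : W₁} {z₂ : W₂} {b : U} {γ₁ : PC (restr f h₁ z₁) b} {γ₂ : PC (restr f h₂ z₂) b}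
    (ε : PC (ContinuousMap.inclusion hW₁ z₁) (ContinuousMap.inclusion hW₂ z₂))
    (e : (Homotopic.Quotient.map ε (restr f h')).trans (raise f h₂ h' hW₂ hU γ₂)
      = raise f h₁ h' hW₁ hU γ₁) :
    ∃ (y₁ : W₁) (y₂ : W₂) (η₁ : PC z₁ y₁) (η₂ : PC z₂ y₂) (ν₁ : PC (restr f h₁ y₁) b)
      (ν₂ : PC (restr f h₂ y₂) b)
      (τ : Path (ContinuousMap.inclusion hW₁ y₁) (ContinuousMap.inclusion hW₂ y₂)),
      IsConst ν₁ ∧ IsConst ν₂ ∧ (Homotopic.Quotient.map η₁ (restr f h₁)).trans ν₁ = γ₁ ∧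
      (Homotopic.Quotient.map η₂ (restr f h₂)).trans ν₂ = γ₂ ∧
      Homotopic.Quotient.mk τ = (Homotopic.Quotient.map η₁ (ContinuousMap.inclusion hW₁)).symm.trans
        (ε.trans (Homotopic.Quotient.map η₂ (ContinuousMap.inclusion hW₂))) ∧
      ∀ t, f (τ t) = b := by
  obtain ⟨y₁, η₁, ν₁, -, hν₁, rfl⟩ := q₁.exists_lift γ₁
  obtain ⟨y₂, η₂, ν₂, -, hν₂, rfl⟩ := q₂.exists_lift γ₂
  rw [raise_trans, raise_trans] at e
  -- Undoing the lift `η₁`, following `ε` and then the lift `η₂` gives a path between two points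
  -- over `b`; by `e` its image is homotopic to a constant path.
  obtain ⟨τ, hτ, hfib⟩ := q'.exists_fibre_path
    ((Homotopic.Quotient.map η₁ (ContinuousMap.inclusion hW₁)).symm.trans
        (ε.trans (Homotopic.Quotient.map η₂ (ContinuousMap.inclusion hW₂))))
    (hν₁.raise f h₁ h' hW₁ hU) (hν₂.raise f h₂ h' hW₂ hU) (by
      rw [BisetGraphs.map_trans, BisetGraphs.map_trans, map_symm]
      simp only [Homotopic.Quotient.trans_assoc]
      rw [e, symm_trans_cancel_left])
  exact ⟨y₁, y₂, η₁, η₂, ν₁, ν₂, τ, hν₁, hν₂, rfl, rfl, hτ, fun t => congrArg Subtype.val (hfib t)⟩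

/-- Pieces of `f⁻¹(U)` related as in `exists_fibre_path_of_raise_eq` are equal. -/
theorem eq_of_raise_eq {W₁ W₂ : Set Z} {h₁ : MapsTo f W₁ U} {h₂ : MapsTo f W₂ U}
    {hW₁ : W₁ ⊆ W'} {hW₂ : W₂ ⊆ W'} (q₁ : HasSquareLifting (restr f h₁))
    (q₂ : HasSquareLifting (restr f h₂)) (q' : HasSquareLifting (restr f h'))
    (c₁ : ∀ y ∈ W₁, W₁ = pathComponentIn (f ⁻¹' U) y)
    (c₂ : ∀ y ∈ W₂, W₂ = pathComponentIn (f ⁻¹' U) y)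
    {z₁ : W₁} {z₂ : W₂} {b : U} {γ₁ : PC (restr f h₁ z₁) b} {γ₂ : PC (restr f h₂ z₂) b}
    (ε : PC (ContinuousMap.inclusion hW₁ z₁) (ContinuousMap.inclusion hW₂ z₂))
    (e : (Homotopic.Quotient.map ε (restr f h')).trans (raise f h₂ h' hW₂ hU γ₂)
      = raise f h₁ h' hW₁ hU γ₁) : W₁ = W₂ := by
  obtain ⟨y₁, y₂, -, -, -, -, τ, -, -, -, -, -, hτ⟩ :=
    exists_fibre_path_of_raise_eq f h' hU q₁ q₂ q' ε e
  -- As `b` lies in `U`, its fibre lies in `f⁻¹(U)`, so `τ` joins the two components there.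
  have hj : JoinedIn (f ⁻¹' U) (y₁ : Z) y₂ :=
    ⟨τ.map continuous_subtype_val, fun t => mem_preimage.2 (mem_of_eq_of_mem (hτ t) b.2)⟩
  rw [c₁ y₁ y₁.2, c₂ y₂ y₂.2]
  exact (pathComponentIn_congr hj).symm

/-- In the situation of `exists_fibre_path_of_raise_eq`, for equal pieces, the path in the bigger
piece comes from the smaller one. -/
theorem exists_lift_of_raise_eq (q : HasSquareLifting (restr f h))
    (q' : HasSquareLifting (restr f h')) (hc : ∀ y ∈ W, W = pathComponentIn (f ⁻¹' U) y)
    {z₁ z₂ : W} {b : U} {γ₁ : PC (restr f h z₁) b} {γ₂ : PC (restr f h z₂) b}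
    (ε : PC (ContinuousMap.inclusion hW z₁) (ContinuousMap.inclusion hW z₂))
    (e : (Homotopic.Quotient.map ε (restr f h')).trans (raise f h h' hW hU γ₂)
      = raise f h h' hW hU γ₁) :
    ∃ ε₀ : PC z₁ z₂, Homotopic.Quotient.map ε₀ (ContinuousMap.inclusion hW) = ε ∧
      (Homotopic.Quotient.map ε₀ (restr f h)).trans γ₂ = γ₁ := by
  obtain ⟨y₁, y₂, η₁, η₂, ν₁, ν₂, τ, hν₁, hν₂, rfl, rfl, hτ, hfib⟩ :=
    exists_fibre_path_of_raise_eq f h' hU q q q' ε e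
  -- The path `τ` starts in `W` and never leaves `f⁻¹(U)`, of which `W` is a path component.
  have hmem : ∀ t, (τ t : Z) ∈ W := by
    intro t
    have hτU : ∀ s, (τ s : Z) ∈ f ⁻¹' U := fun s =>
      mem_preimage.2 (mem_of_eq_of_mem (hfib s) b.2)
    have := contractibleSpace_unitInterval
    have hsub := (isPathConnected_range (continuous_subtype_val.comp
      τ.continuous)).subset_pathComponentIn (x := (y₁ : Z)) (F := f ⁻¹' U)
        ⟨0, congrArg Subtype.val τ.source⟩ (by rintro _ ⟨s, rfl⟩; exact hτU s)
    exact (hc y₁ y₁.2).ge (hsub ⟨t, rfl⟩)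
  have hs : (τ 0 : Z) = y₁ := congrArg Subtype.val τ.source
  have ht : (τ 1 : Z) = y₂ := congrArg Subtype.val τ.target
  let τ₀ : Path y₁ y₂ :=
    { toFun := fun t => ⟨τ t, hmem t⟩
      continuous_toFun := by fun_prop
      source' := Subtype.ext hs
      target' := Subtype.ext ht }
  have hτ₀ : Homotopic.Quotient.map (Homotopic.Quotient.mk τ₀) (ContinuousMap.inclusion hW)
      = Homotopic.Quotient.mk τ := rfl
  -- This solves `τ = η₁⁻¹ # ε # η₂` for `ε`, now inside `W`.
  refine ⟨η₁.trans ((Homotopic.Quotient.mk τ₀).trans η₂.symm), ?_, ?_⟩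
  · rw [BisetGraphs.map_trans, BisetGraphs.map_trans, map_symm, hτ₀, hτ]
    simp only [Homotopic.Quotient.trans_assoc, Homotopic.Quotient.trans_symm,
      Homotopic.Quotient.trans_refl, trans_symm_cancel_left]
  · rw [BisetGraphs.map_trans, BisetGraphs.map_trans, map_symm]
    simp only [Homotopic.Quotient.trans_assoc, symm_trans_cancel_left]
    rw [IsConst.map_trans (restr f h) τ₀ (fun t => Subtype.ext (hfib t)) hν₁ hν₂]

end Raise

/-! ### Restrictions of fibrations and of coverings -/

section Restriction

variable {X : Type u} {Z : Type w} [TopologicalSpace X] [TopologicalSpace Z] {f : C(Z, X)}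

/-- The interval is a legitimate test space only after `ULift` to the universe that `IsFibration`
quantifies over. -/
theorem IsFibration.hasSquareLifting (hf : IsFibration f) : HasSquareLifting f := by
  intro g h hgh
  obtain ⟨G, hG, hfG⟩ := hf (ULift.{max u w} I) (g.comp ⟨fun p => (p.1.down, p.2), by fun_prop⟩)
    (h.comp ⟨ULift.down, by fun_prop⟩) (fun a => hgh a.down)
  exact ⟨G.comp ⟨fun p => (ULift.up p.1, p.2), by fun_prop⟩, fun s => hG (ULift.up s),
    fun p => hfG (ULift.up p.1, p.2)⟩

/-- A square lifted to `Z` stays in `W`: its image is path connected, lies in `f⁻¹(U)` and meets the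
component `W`. -/
theorem HasSquareLifting.restr (hf : HasSquareLifting f) {W : Set Z} {U : Set X}
    (h : MapsTo f W U) (hc : ∀ y ∈ W, W = pathComponentIn (f ⁻¹' U) y) :
    HasSquareLifting (restr f h) := by
  intro g k hgk
  obtain ⟨G, hG, hfG⟩ := hf ((⟨Subtype.val, continuous_subtype_val⟩ : C(U, X)).comp g)
    ((⟨Subtype.val, continuous_subtype_val⟩ : C(W, Z)).comp k)
    (fun s => congrArg Subtype.val (hgk s))
  have hmem : ∀ p, G p ∈ W := by
    intro p
    have := contractibleSpace_unitInterval
    have hsub := (isPathConnected_range G.continuous).subset_pathComponentIn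
      (x := (k 0 : Z)) (F := f ⁻¹' U)
      ⟨(0, 0), hG 0⟩ (by
        rintro _ ⟨s, rfl⟩
        change f (G s) ∈ U
        rw [hfG]
        exact (g s).2)
    exact (hc (k 0) (k 0).2).ge (hsub ⟨p, rfl⟩)
  exact ⟨⟨fun p => ⟨G p, hmem p⟩, by fun_prop⟩, fun s => Subtype.ext (hG s),
    fun p => Subtype.ext (hfG p)⟩

theorem isFibration_of_isCoveringMap (hf : IsCoveringMap f) : IsFibration f := by
  intro A _ g h hgh
  let H : C(I × A, X) := g.comp ContinuousMap.prodSwap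
  have H0 : ∀ a, H (0, a) = f (h a) := fun a => (hgh a).symm
  refine ⟨(hf.liftHomotopy H h H0).comp ContinuousMap.prodSwap,
    fun a => hf.liftHomotopy_zero H h H0 a, fun p => ?_⟩
  exact congrFun (hf.liftHomotopy_lifts H h H0) (p.2, p.1)

/-- A covering is injective on fundamental groups of path components of preimages. -/
theorem eq_one_of_smul_eq (hf : IsCoveringMap f) {W : Set Z} {U : Set X}
    (h : MapsTo f W U) (hc : ∀ y ∈ W, W = pathComponentIn (f ⁻¹' U) y) {a : W} {b : U}
    (δ : Pi1 a) (γ : MapBiset (BisetGraphs.restr f h) a b) (e : δ • γ = γ) : δ = 1 := by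
  -- Cancelling `γ` shows that the image of `δ` is trivial, so `δ` is represented by a loop in a
  -- fibre.
  have e₁ : (Path.Homotopic.Quotient.map δ (BisetGraphs.restr f h)).trans
      (Path.Homotopic.Quotient.refl _) = Path.Homotopic.Quotient.refl _ := by
    rw [Path.Homotopic.Quotient.trans_refl]
    exact trans_right_cancel (A := U) γ
      (Eq.trans e (Path.Homotopic.Quotient.refl_trans (X := U) γ).symm)
  have hr : IsConst (Path.Homotopic.Quotient.refl (BisetGraphs.restr f h a)) :=
    ⟨Path.refl _, rfl, fun _ => rfl⟩
  obtain ⟨τ, rfl, hτ⟩ := ((isFibration_of_isCoveringMap hf).hasSquareLifting.restr h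
    hc).exists_fibre_path δ hr hr e₁
  refine IsConst.eq_refl ⟨τ, rfl, fun t => Subtype.ext ?_⟩
  have hτ' : ∀ t, f (τ t) = f a := fun t => congrArg Subtype.val (hτ t)
  -- Fibres of a covering are discrete, so a path inside one is constant.
  have := hf.const_of_comp (g := fun t => (τ t : Z)) (by fun_prop)
    (fun s t => (hτ' s).trans (hτ' t).symm) t 0
  simpa using this

end Restriction

/-! ### Equality in tensor products, transitivity of the right actions -/

/-- Since `K` is a group, differing by one element of `K` is already an equivalence relation, and a
chain of elementary moves collapses to a single move. -/
theorem Tensor.mk_eq_mk {K : Type u} {B : Type v} {C : Type w} [Group K] [MulAction Kᵐᵒᵖ B]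
    [MulAction K C] {b b' : B} {c c' : C} (h : (Tensor.mk b c : Tensor K B C) = Tensor.mk b' c') :
    ∃ k : K, b' = MulOpposite.op k • b ∧ c = k • c' := by
  have key : ∀ x y : B × C, Relation.EqvGen (TensorRel K B C) x y →
      ∃ k : K, y.1 = MulOpposite.op k • x.1 ∧ x.2 = k • y.2 := by
    intro x y hxy
    induction hxy with
    | rel x y h =>
      obtain ⟨b, k, c⟩ := h
      exact ⟨k⁻¹, by simp [← mul_smul], by simp⟩
    | refl x => exact ⟨1, by simp, by simp⟩
    | symm x y _ ih =>
      obtain ⟨k, h₁, h₂⟩ := ih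
      exact ⟨k⁻¹, by simp [h₁], by simp [h₂]⟩
    | trans x y z _ _ ih₁ ih₂ =>
      obtain ⟨k, h₁, h₂⟩ := ih₁
      obtain ⟨l, h₃, h₄⟩ := ih₂
      exact ⟨k * l, by rw [h₃, h₁, MulOpposite.op_mul, mul_smul], by rw [h₂, h₄, mul_smul]⟩
  exact key _ _ (Quot.eqvGen_exact h)

section MapBisetTorsor

variable {A : Type u} {B : Type v} [TopologicalSpace A] [TopologicalSpace B] {φ : C(A, B)}
  {a : A} {b : B}

/-- Two paths with common endpoints differ by the loop `x⁻¹ # y`. With the cancellation below, the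
right action is simply transitive, so first factors in `B(i)^∨` can always be matched, in exactly
one way. -/
theorem MapBiset.exists_op_smul_eq (x y : MapBiset φ a b) :
    ∃ g : Pi1 b, MulOpposite.op g • x = y :=
  ⟨Path.Homotopic.Quotient.trans (Path.Homotopic.Quotient.symm x) y,
    trans_symm_cancel_left (A := B) x y⟩

theorem MapBiset.op_smul_left_injective (x : MapBiset φ a b) {g g' : Pi1 b}
    (h : MulOpposite.op g • x = MulOpposite.op g' • x) : g = g' :=
  trans_left_cancel (A := B) x h

end MapBisetTorsor

/-! ### The congruences between bisets of restricted correspondences -/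

section CorrPush

open Path MulOpposite

variable {X : Type u} {Y : Type v} {Z : Type w}
  [TopologicalSpace X] [TopologicalSpace Y] [TopologicalSpace Z] (f : C(Z, X)) (i : C(Z, Y))
  {W₁ W₂ W' : Set Z} {U U' : Set X} {V₁ V₂ V' : Set Y}
  (hf₁ : MapsTo f W₁ U) (hi₁ : MapsTo i W₁ V₁) (hf₂ : MapsTo f W₂ U) (hi₂ : MapsTo i W₂ V₂)
  (hf' : MapsTo f W' U') (hi' : MapsTo i W' V')
  (hW₁ : W₁ ⊆ W') (hW₂ : W₂ ⊆ W') (hU : U ⊆ U') (hV₁ : V₁ ⊆ V') (hV₂ : V₂ ⊆ V')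
  {a₁ : W₁} {a₂ : W₂} {a' : W'} {b : U} {b' : U'} {p₁ : V₁} {p₂ : V₂} {p' : V'}
  (κ₁ : PC (ContinuousMap.inclusion hW₁ a₁) a') (κ₂ : PC (ContinuousMap.inclusion hW₂ a₂) a')
  (ℓ : PC (ContinuousMap.inclusion hU b) b')
  (m₁ : PC (ContinuousMap.inclusion hV₁ p₁) p') (m₂ : PC (ContinuousMap.inclusion hV₂ p₂) p')

/-- The left action touches only the contragredient factor, so `Tensor.mk_eq_mk` turns the equality
into a single loop of `W'` linking both factors. -/
theorem exists_loop_of_corrPush_eq (g₁ g₂ : Pi1 p')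
    (β₁ : MapBiset (restr i hi₁) a₁ p₁) (γ₁ : MapBiset (restr f hf₁) a₁ b)
    (β₂ : MapBiset (restr i hi₂) a₂ p₂) (γ₂ : MapBiset (restr f hf₂) a₂ b)
    (e : g₁ • corrPush f i hf₁ hi₁ hf' hi' hW₁ hU hV₁ κ₁ ℓ m₁ (Tensor.mk (Contra.mk β₁) γ₁)
      = g₂ • corrPush f i hf₂ hi₂ hf' hi' hW₂ hU hV₂ κ₂ ℓ m₂ (Tensor.mk (Contra.mk β₂) γ₂)) :
    ∃ δ : Pi1 a', push f hf₁ hf' hW₁ hU κ₁ ℓ γ₁ = δ • push f hf₂ hf' hW₂ hU κ₂ ℓ γ₂ ∧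
      op g₂⁻¹ • push i hi₂ hi' hW₂ hV₂ κ₂ m₂ β₂
        = δ⁻¹ • op g₁⁻¹ • push i hi₁ hi' hW₁ hV₁ κ₁ m₁ β₁ := by
  obtain ⟨δ, h₁, h₂⟩ := Tensor.mk_eq_mk (K := Pi1 a')
    (b := Contra.mk (op g₁⁻¹ • push i hi₁ hi' hW₁ hV₁ κ₁ m₁ β₁))
    (b' := Contra.mk (op g₂⁻¹ • push i hi₂ hi' hW₂ hV₂ κ₂ m₂ β₂)) e
  exact ⟨δ, h₂, h₁⟩

/-- Elements of two bisets with the same image, up to the left action, come from the same piece. -/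
theorem eq_of_corrPush_eq (q₁ : HasSquareLifting (restr f hf₁))
    (q₂ : HasSquareLifting (restr f hf₂)) (q' : HasSquareLifting (restr f hf'))
    (c₁ : ∀ y ∈ W₁, W₁ = pathComponentIn (f ⁻¹' U) y)
    (c₂ : ∀ y ∈ W₂, W₂ = pathComponentIn (f ⁻¹' U) y) (g₁ g₂ : Pi1 p')
    (t₁ : CorrBiset f i hf₁ hi₁ a₁ p₁ b) (t₂ : CorrBiset f i hf₂ hi₂ a₂ p₂ b)
    (e : g₁ • corrPush f i hf₁ hi₁ hf' hi' hW₁ hU hV₁ κ₁ ℓ m₁ t₁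
      = g₂ • corrPush f i hf₂ hi₂ hf' hi' hW₂ hU hV₂ κ₂ ℓ m₂ t₂) : W₁ = W₂ := by
  induction t₁ using Tensor.ind with | h β₁ γ₁ => ?_
  induction t₂ using Tensor.ind with | h β₂ γ₂ => ?_
  obtain ⟨δ, h₁, -⟩ := exists_loop_of_corrPush_eq f i hf₁ hi₁ hf₂ hi₂ hf' hi' hW₁ hW₂ hU hV₁ hV₂
    κ₁ κ₂ ℓ m₁ m₂ g₁ g₂ β₁.val γ₁ β₂.val γ₂ e
  exact eq_of_raise_eq f hf' hU q₁ q₂ q' c₁ c₂ _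
    (raise_eq_of_push_eq f hf₁ hf' hW₁ hU hf₂ hW₂ κ₁ κ₂ ℓ γ₁ γ₂ δ h₁)

/-- The map `g ⊗ b ↦ g · corrPush b` is injective on a single piece. -/
theorem exists_smul_eq_of_corrPush_eq (q₁ : HasSquareLifting (restr f hf₁))
    (q' : HasSquareLifting (restr f hf'))
    (c₁ : ∀ y ∈ W₁, W₁ = pathComponentIn (f ⁻¹' U) y) (g₁ g₂ : Pi1 p')
    (t₁ t₂ : CorrBiset f i hf₁ hi₁ a₁ p₁ b)
    (e : g₁ • corrPush f i hf₁ hi₁ hf' hi' hW₁ hU hV₁ κ₁ ℓ m₁ t₁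
      = g₂ • corrPush f i hf₁ hi₁ hf' hi' hW₁ hU hV₁ κ₁ ℓ m₁ t₂) :
    ∃ k : Pi1 p₁, t₁ = k • t₂ ∧ g₁ * conjHom (ContinuousMap.inclusion hV₁) m₁ k = g₂ := by
  induction t₁ using Tensor.ind with | h β₁ γ₁ => ?_
  induction t₂ using Tensor.ind with | h β₂ γ₂ => ?_
  obtain ⟨δ, h₁, h₂⟩ := exists_loop_of_corrPush_eq f i hf₁ hi₁ hf₁ hi₁ hf' hi' hW₁ hW₁ hU hV₁ hV₁
    κ₁ κ₁ ℓ m₁ m₁ g₁ g₂ β₁.val γ₁ β₂.val γ₂ e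
  obtain ⟨ε, hε, hγ⟩ := exists_lift_of_raise_eq f hf₁ hf' hW₁ hU q₁ q' c₁ _
    (raise_eq_of_push_eq f hf₁ hf' hW₁ hU hf₁ hW₁ κ₁ κ₁ ℓ γ₁ γ₂ δ h₁)
  -- Here `ε` becomes `κ₁ # δ # κ₁⁻¹` in `W'`, so the loop `δ` comes from the smaller piece.
  have hconj : conjHom (ContinuousMap.inclusion hW₁) κ₁ ε = δ := by
    change κ₁.symm.trans ((Homotopic.Quotient.map ε _).trans κ₁) = δ
    rw [hε]
    simp only [Homotopic.Quotient.trans_assoc, Homotopic.Quotient.symm_trans,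
      Homotopic.Quotient.trans_refl, symm_trans_cancel_left]
  replace hγ : γ₁ = (show Pi1 a₁ from ε) • γ₂ := hγ.symm
  -- Moving `ε` from `γ₁ = ε · γ₂` across the tensor sign replaces `β₁` by `ε⁻¹ · β₁`, which is `β₂
  -- · k`. On contragredients this is the left action of `k⁻¹`.
  obtain ⟨k, hk⟩ := MapBiset.exists_op_smul_eq β₂.val ((show Pi1 a₁ from ε)⁻¹ • β₁.val)
  refine ⟨k⁻¹, ?_, ?_⟩
  · rw [hγ, ← Tensor.balanced]
    refine congrArg (Tensor.mk · γ₂) ?_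
    change Contra.mk ((show Pi1 a₁ from ε)⁻¹ • β₁.val) = Contra.mk (op k⁻¹⁻¹ • β₂.val)
    rw [inv_inv, hk]
  · rw [smul_comm, ← hconj, ← map_inv, ← push_left, ← hk, push_right, ← mul_smul,
      ← op_mul] at h₂
    have h₃ := MapBiset.op_smul_left_injective _ h₂
    rw [← inv_inj, h₃, mul_inv_rev, map_inv, inv_inv]

/-- A pure tensor whose second factor ends, after lifting, in a piece, is up to the left action in
the image of `corrPush` from this piece. -/
theorem exists_smul_corrPush_eq {y : W₁} (η : PC a₁ y) (β₀ : MapBiset (restr i hi₁) a₁ p₁)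
    (β : MapBiset (restr i hi') a' p') (γ : MapBiset (restr f hf') a' b')
    (γ' : PC a' (ContinuousMap.inclusion hW₁ y))
    {ν : PC (restr f hf' (ContinuousMap.inclusion hW₁ y)) (ContinuousMap.inclusion hU b)}
    (hν : IsConst ν) (hy : restr f hf₁ y = b)
    (e : (Homotopic.Quotient.map γ' (restr f hf')).trans ν
      = Homotopic.Quotient.trans γ ℓ.symm) :
    ∃ (g : Pi1 p') (t : CorrBiset f i hf₁ hi₁ a₁ p₁ b),
      g • corrPush f i hf₁ hi₁ hf' hi' hW₁ hU hV₁ κ₁ ℓ m₁ t = Tensor.mk (Contra.mk β) γ := by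
  obtain ⟨ν₀, hν₀⟩ := exists_isConst hy
  obtain rfl := hν.eq (hν₀.raise f hf₁ hf' hW₁ hU)
  let c : MapBiset (restr f hf₁) a₁ b := (Homotopic.Quotient.map η (restr f hf₁)).trans ν₀
  -- Follow the lift `γ'` to `y`, return along `η` to the basepoint of `W₁`, then take `κ₁`: this
  -- loop is the discrepancy between `γ` and the class pushed from `W₁`.
  let δ : Pi1 a' :=
    γ'.trans ((Homotopic.Quotient.map η (ContinuousMap.inclusion hW₁)).symm.trans κ₁)
  have hc : γ = δ • push f hf₁ hf' hW₁ hU κ₁ ℓ c := by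
    change _ = (Homotopic.Quotient.map (γ'.trans _) _).trans (Homotopic.Quotient.trans _
      ((raise f hf₁ hf' hW₁ hU ((Homotopic.Quotient.map η _).trans ν₀)).trans ℓ))
    have e₁ := congrArg (Homotopic.Quotient.trans · ℓ) e
    rw [raise_trans, BisetGraphs.map_trans, BisetGraphs.map_trans, map_symm]
    simp only [Homotopic.Quotient.trans_assoc, trans_symm_cancel_left, symm_trans_cancel_left]
    exact (((Homotopic.Quotient.trans_assoc _ _ _).symm.trans e₁).trans
      (trans_symm_trans_cancel (A := U') γ ℓ)).symm
  -- By transitivity any `β₀` will do; only its existence matters.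
  obtain ⟨g, hg⟩ := MapBiset.exists_op_smul_eq (push i hi₁ hi' hW₁ hV₁ κ₁ m₁ β₀) (δ⁻¹ • β)
  refine ⟨g⁻¹, Tensor.mk (Contra.mk β₀) c, ?_⟩
  rw [hc, ← Tensor.balanced]
  refine congrArg (Tensor.mk · (push f hf₁ hf' hW₁ hU κ₁ ℓ c)) ?_
  change Contra.mk (op g⁻¹⁻¹ • push i hi₁ hi' hW₁ hV₁ κ₁ m₁ β₀) = Contra.mk (δ⁻¹ • β)
  rw [inv_inv, hg]

end CorrPush

/-! ### Covers, pullback covers -/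

section Covers

/-- Two indices of one piece would form a chain `U a ⊆ U b ⊆ U a`, which the dimension condition
forbids. Equal pieces thus give equal objects of the graph. -/
theorem IsFiniteOneDimCover.injective {X : Type u} [TopologicalSpace X] {J : Type u₁}
    {U : J → Set X} (hU : IsFiniteOneDimCover U) : Function.Injective U := fun a b h => by
  rcases hU.dim a b a h.le h.ge with rfl | rfl <;> rfl

theorem IsPullbackCover.eq_pathComponentIn {X : Type u} {Z : Type w} [TopologicalSpace Z]
    {J : Type u₁} {K : Type u₃} {f : Z → X} {U : J → Set X} {W : K → Set Z} {ρ : K → J}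
    (hpull : IsPullbackCover f U W ρ) (c : K) :
    ∀ y ∈ W c, W c = pathComponentIn (f ⁻¹' U (ρ c)) y := by
  intro y hy
  obtain ⟨z, -, hW⟩ := hpull.1 c
  rw [hW] at hy ⊢
  exact (pathComponentIn_congr hy).symm

theorem Marking.castHom_bijective {X : Type u} [TopologicalSpace X] {J : Type u₁} {U : J → Set X}
    (M : Marking U) {a b : J} (h : a = b) : Function.Bijective (M.castHom h) := by
  subst h
  exact Function.bijective_id

theorem Compatible.actHom_bijective {X : Type u} [TopologicalSpace X] {J : Type u₁}
    {U : J → Set X} (M : Marking U) {Z : Type w} {K : Type u₃} {f : Z → X} {W : K → Set Z}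
    {r : K → J} (hr : Compatible f W U r) (x : (coverGraph W).Obj) :
    Function.Bijective (hr.actHom M x) :=
  M.castHom_bijective _

end Covers

/-- The relation defining the source of `edgeMap`. -/
theorem GraphOfBisets.mk_eq_mk_of_smul_eq {Y : GraphOfGroups.{u₁, u₂}} {X : GraphOfGroups.{u₃, u₄}}
    (𝔅 : GraphOfBisets.{u₁, u₂, u₃, u₄, u₅, u₆} Y X) {e v : 𝔅.Obj} (he : 𝔅.orig e = v)
    {g g' : Y.G (𝔅.lam.toFun v)} {b b' : 𝔅.B e} (k : Y.G (𝔅.lam.toFun e)) (hb : b = k • b')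
    (hg : g * 𝔅.leftHom he k = g') :
    (Tensor.mk (ViaHom.mk (𝔅.leftHom he) g) b :
      Tensor (Y.G (𝔅.lam.toFun e)) (ViaHom (𝔅.leftHom he)) (𝔅.B e))
      = Tensor.mk (ViaHom.mk (𝔅.leftHom he) g') b' := by
  subst hb hg
  exact (Tensor.balanced _ k _).symm

/-! ### Edges of the graph of `W` lying over a given edge. -/

section GraphHom

open CoverObj

variable {X : Type u} {Z : Type w} {J : Type u₁} {K : Type u₃} {f : Z → X} {W : K → Set Z}
  {U : J → Set X} {r : K → J} (hr : Compatible f W U r)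

theorem Compatible.exists_eq_down {e : CoverObj W} {c : K} {a b : J} {hab : U a ⊂ U b}
    (he : hr.graphHom.toFun e = down a b hab) (ho : (coverGraph W).orig e = vert c) :
    ∃ (c' : K) (h : W c' ⊂ W c), e = down c' c h ∧ r c' = a := by
  cases e with
  | vert c' => cases he
  | up c' d h =>
    change upObj (r c') (r d) (hr.mono c' d h) = _ at he
    unfold upObj at he
    split_ifs at he
  | down c' d h =>
    cases ho
    change downObj (r c') (r c) (hr.mono c' c h) = _ at he
    unfold downObj at he
    split_ifs at he
    cases he
    exact ⟨c', h, rfl, rfl⟩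

theorem Compatible.exists_eq_up {e : CoverObj W} {c : K} {a b : J} {hab : U a ⊂ U b}
    (he : hr.graphHom.toFun e = up a b hab) (ho : (coverGraph W).orig e = vert c) :
    ∃ (d : K) (h : W c ⊂ W d), e = up c d h ∧ r d = b := by
  cases e with
  | vert c' => cases he
  | down c' d h =>
    change downObj (r c') (r d) (hr.mono c' d h) = _ at he
    unfold downObj at he
    split_ifs at he
  | up c' d h =>
    cases ho
    change upObj (r c) (r d) (hr.mono c d h) = _ at he
    unfold upObj at he
    split_ifs at he
    cases he
    exact ⟨d, h, rfl, rfl⟩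

end GraphHom

/-! ### The graph of bisets of a correspondence with a pullback cover -/

section PullbackCorrespondence

open CoverObj

variable {X : Type u} {Y : Type v} {Z : Type w}
  [TopologicalSpace X] [TopologicalSpace Y] [TopologicalSpace Z] (f : C(Z, X)) (i : C(Z, Y))
  {J : Type u₁} {L : Type u₂} {K : Type u₃} {U : J → Set X} {V : L → Set Y} {W : K → Set Z}
  (MU : Marking U) (MV : Marking V) (MW : Marking W) {ρ : K → J} {lam : K → L}
  (hρ : Compatible f W U ρ) (hl : Compatible i W V lam)

/-- Surjectivity over a descending edge: the end of the lift of `γ # ℓ⁻¹` selects the piece `c'`. -/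
theorem exists_smul_pieceMap_eq (hV : IsFiniteOneDimCover V) (hW : IsFiniteOneDimCover W)
    (hpull : IsPullbackCover f U W ρ) (hq : HasSquareLifting f) {c : K} {a : J}
    (hab : U a ⊂ U (ρ c)) (t : PieceBiset f i MU MV MW hρ hl c) :
    ∃ (c' : K) (h : W c' ⊂ W c), ρ c' = a ∧ ∃ (g : Pi1 (MV.pt (lam c)))
      (b : PieceBiset f i MU MV MW hρ hl c'), g • pieceMap f i MU MV MW hρ hl h b = t := by
  induction t using Tensor.ind with | h β γ => ?_
  obtain ⟨y, γ', ν, hy, hν, e⟩ :=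
    (hq.restr (hρ.mapsTo c) (hpull.eq_pathComponentIn c)).exists_lift
      (Path.Homotopic.Quotient.trans (X := U (ρ c)) γ (MU.link (Or.inr hab)).symm)
  have hya : (y : Z) ∈ f ⁻¹' U a := by
    have : f y = MU.pt a := congrArg Subtype.val hy
    exact mem_preimage.2 (mem_of_eq_of_mem this (MU.pt a).2)
  obtain ⟨c', rfl, hc'⟩ := hpull.2 a y hya
  have hfy : f y = MU.pt (ρ c') := congrArg Subtype.val hy
  have hyc' : (y : Z) ∈ W c' := hc'.ge (mem_pathComponentIn_self hya)
  have hsub : W c' ⊆ W c := by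
    have hc := hpull.eq_pathComponentIn c y y.2
    rw [hc']
    exact (pathComponentIn_mono (preimage_mono hab.subset)).trans hc.ge
  have hne : W c' ≠ W c := by
    intro h
    obtain rfl := hW.injective h
    exact ssubset_irrefl _ hab
  have h : W c' ⊂ W c := hsub.ssubset_of_ne hne
  -- Connectedness of `W c'` provides the path from its basepoint to `y`, and that of `V (lam c')`
  -- an element `β₀` of the biset of `i`.
  have hWc : PathConnectedSpace (W c') :=
    isPathConnected_iff_pathConnectedSpace.1 (hW.isPathConnected c')
  have hVc : PathConnectedSpace (V (lam c')) :=
    isPathConnected_iff_pathConnectedSpace.1 (hV.isPathConnected (lam c'))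
  exact ⟨c', h, rfl, exists_smul_corrPush_eq f i (hρ.mapsTo c') (hl.mapsTo c') (hρ.mapsTo c)
    (hl.mapsTo c) hsub hab.subset (hl.mono c' c h).subset (MW.link (Or.inr h))
    (MU.link (Or.inr hab)) (MV.link (hl.mono c' c h)) (y := ⟨y, hyc'⟩)
    (Path.Homotopic.Quotient.mk (PathConnectedSpace.somePath _ _))
    (Path.Homotopic.Quotient.mk (PathConnectedSpace.somePath _ _)) β.val γ γ' hν
    (Subtype.ext hfy) e⟩

theorem eq_of_pieceMap_eq (hW : IsFiniteOneDimCover W)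
    (hpull : IsPullbackCover f U W ρ) (hq : HasSquareLifting f) {c c₁ c₂ : K}
    (h₁ : W c₁ ⊂ W c) (h₂ : W c₂ ⊂ W c) (hr : ρ c₂ = ρ c₁) (g₁ g₂ : Pi1 (MV.pt (lam c)))
    (t₁ : PieceBiset f i MU MV MW hρ hl c₁) (t₂ : PieceBiset f i MU MV MW hρ hl c₂)
    (e : g₁ • pieceMap f i MU MV MW hρ hl h₁ t₁ = g₂ • pieceMap f i MU MV MW hρ hl h₂ t₂) :
    c₁ = c₂ := by
  -- Neither side of `ρ c₂ = ρ c₁` is a variable, and the type of `t₂` depends on `ρ c₂`. Replacing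
  -- `ρ c₂` by a free index `r` makes the substitution possible.
  have key : ∀ (r : J) (_ : r = ρ c₁) (hf₂ : MapsTo f (W c₂) (U r)) (hle : CoverLE U r (ρ c))
      (_ : ∀ y ∈ W c₂, W c₂ = pathComponentIn (f ⁻¹' U r) y)
      (s : CorrBiset f i hf₂ (hl.mapsTo c₂) (MW.pt c₂) (MV.pt (lam c₂)) (MU.pt r))
      (_ : g₁ • pieceMap f i MU MV MW hρ hl h₁ t₁ = g₂ • corrPush f i hf₂ (hl.mapsTo c₂)
        (hρ.mapsTo c) (hl.mapsTo c) h₂.subset hle.subset (hl.mono c₂ c h₂).subset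
        (MW.link (Or.inr h₂)) (MU.link hle) (MV.link (hl.mono c₂ c h₂)) s), W c₁ = W c₂ := by
    rintro r rfl hf₂ hle hc₂ s es
    exact eq_of_corrPush_eq f i (hρ.mapsTo c₁) (hl.mapsTo c₁) hf₂ (hl.mapsTo c₂) (hρ.mapsTo c)
      (hl.mapsTo c) h₁.subset h₂.subset hle.subset (hl.mono c₁ c h₁).subset
      (hl.mono c₂ c h₂).subset (MW.link (Or.inr h₁)) (MW.link (Or.inr h₂)) (MU.link hle)
      (MV.link (hl.mono c₁ c h₁)) (MV.link (hl.mono c₂ c h₂))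
      (hq.restr _ (hpull.eq_pathComponentIn c₁)) (hq.restr _ hc₂)
      (hq.restr _ (hpull.eq_pathComponentIn c)) (hpull.eq_pathComponentIn c₁) hc₂ g₁ g₂ t₁ s es
  exact hW.injective (key (ρ c₂) hr (hρ.mapsTo c₂) (hρ.mono c₂ c h₂)
    (hpull.eq_pathComponentIn c₂) t₂ e)

theorem exists_smul_eq_of_pieceMap_eq (hpull : IsPullbackCover f U W ρ) (hq : HasSquareLifting f)
    {c c' : K} (h : W c' ⊂ W c) (g₁ g₂ : Pi1 (MV.pt (lam c)))
    (t₁ t₂ : PieceBiset f i MU MV MW hρ hl c')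
    (e : g₁ • pieceMap f i MU MV MW hρ hl h t₁ = g₂ • pieceMap f i MU MV MW hρ hl h t₂) :
    ∃ k : Pi1 (MV.pt (lam c')), t₁ = k • t₂ ∧ g₁ * MV.trans (hl.mono c' c h) k = g₂ :=
  exists_smul_eq_of_corrPush_eq f i (hρ.mapsTo c') (hl.mapsTo c') (hρ.mapsTo c) (hl.mapsTo c)
    h.subset (hρ.mono c' c h).subset (hl.mono c' c h).subset (MW.link (Or.inr h))
    (MU.link (hρ.mono c' c h)) (MV.link (hl.mono c' c h))
    (hq.restr _ (hpull.eq_pathComponentIn c')) (hq.restr _ (hpull.eq_pathComponentIn c))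
    (hpull.eq_pathComponentIn c') g₁ g₂ t₁ t₂ e

/-- An edge collapses only if nested pieces have the same `ρ`. They would then be intersecting
components of one preimage, hence equal, against strictness. -/
theorem isSimplicial_gHom (hW : IsFiniteOneDimCover W) (hpull : IsPullbackCover f U W ρ) :
    (hρ.gHom MU).IsSimplicial := by
  have hne : ∀ c d, W c ⊂ W d → ρ c ≠ ρ d := by
    intro c d h hr
    obtain ⟨z, hz⟩ := (hW.isPathConnected c).nonempty
    have h₁ := hpull.eq_pathComponentIn c z hz
    have h₂ := hpull.eq_pathComponentIn d z (h.subset hz)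
    rw [hr, ← h₂] at h₁
    exact h.ne h₁
  rintro (c | ⟨c, d, h⟩ | ⟨c, d, h⟩) hx
  · exact absurd ⟨c, rfl⟩ hx
  · rintro ⟨a, ha⟩
    change upObj (ρ c) (ρ d) (hρ.mono c d h) = _ at ha
    unfold upObj at ha
    rw [dif_neg (hne c d h)] at ha
    cases ha
  · rintro ⟨a, ha⟩
    change downObj (ρ c) (ρ d) (hρ.mono c d h) = _ at ha
    unfold downObj at ha
    rw [dif_neg (hne c d h)] at ha
    cases ha

theorem unionMap_down_bijective (hV : IsFiniteOneDimCover V) (hW : IsFiniteOneDimCover W)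
    (hpull : IsPullbackCover f U W ρ) (hq : HasSquareLifting f) (c : K) (a : J)
    (hab : U a ⊂ U (ρ c)) :
    Function.Bijective ((corrGraphOfBisets f i MU MV MW hρ hl).unionMap (vert c)
      (down a (ρ c) hab)) := by
  constructor
  · rintro ⟨⟨e₁, hr₁, ho₁⟩, T₁⟩ ⟨⟨e₂, hr₂, ho₂⟩, T₂⟩ e
    obtain ⟨c₁, h₁, rfl, rfl⟩ := hρ.exists_eq_down hr₁ ho₁
    obtain ⟨c₂, h₂, rfl, hr⟩ := hρ.exists_eq_down hr₂ ho₂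
    induction T₁ using Tensor.ind with | h g₁ t₁ => ?_
    induction T₂ using Tensor.ind with | h g₂ t₂ => ?_
    obtain rfl := eq_of_pieceMap_eq f i MU MV MW hρ hl hW hpull hq h₁ h₂ hr g₁ g₂ t₁ t₂ e
    obtain ⟨k, hk, hg⟩ := exists_smul_eq_of_pieceMap_eq f i MU MV MW hρ hl hpull hq h₁ g₁ g₂ t₁ t₂ e
    -- The loop `k` lies in the group of the piece, while the tensor product is over the group at
    -- `λ` of the edge; `actHom` identifies the two.
    obtain ⟨k, rfl⟩ := (hl.actHom_bijective MV (down c₁ c h₁)).2 k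
    rw [← hl.actHom_minus_down] at hg
    exact congrArg (Sigma.mk _) (GraphOfBisets.mk_eq_mk_of_smul_eq
      (corrGraphOfBisets f i MU MV MW hρ hl) ho₁ k hk hg)
  · intro t
    obtain ⟨c', h, rfl, g, b, hb⟩ := exists_smul_pieceMap_eq f i MU MV MW hρ hl hV hW hpull hq hab t
    exact ⟨⟨⟨down c' c h, downObj_of_ssubset _ _ hab, rfl⟩,
      Tensor.mk (ViaHom.mk _ g) b⟩, hb⟩

theorem unionMap_up_bijective (hW : IsFiniteOneDimCover W)
    (hpull : IsPullbackCover f U W ρ) (c : K) (b : J) (hab : U (ρ c) ⊂ U b) :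
    Function.Bijective ((corrGraphOfBisets f i MU MV MW hρ hl).unionMap (vert c)
      (up (ρ c) b hab)) := by
  obtain ⟨z, hz⟩ := (hW.isPathConnected c).nonempty
  constructor
  · rintro ⟨⟨e₁, hr₁, ho₁⟩, T₁⟩ ⟨⟨e₂, hr₂, ho₂⟩, T₂⟩ e
    obtain ⟨d₁, h₁, rfl, rfl⟩ := hρ.exists_eq_up hr₁ ho₁
    obtain ⟨d₂, h₂, rfl, hr⟩ := hρ.exists_eq_up hr₂ ho₂
    -- Both are the component of `z` in the same preimage.
    obtain rfl : d₁ = d₂ := hW.injective (by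
      rw [hpull.eq_pathComponentIn d₁ z (h₁.subset hz),
        hpull.eq_pathComponentIn d₂ z (h₂.subset hz), hr])
    induction T₁ using Tensor.ind with | h g₁ t₁ => ?_
    induction T₂ using Tensor.ind with | h g₂ t₂ => ?_
    replace e : @HSMul.hSMul (Pi1 (MV.pt (lam c))) (PieceBiset f i MU MV MW hρ hl c) _ _ g₁ t₁
      = @HSMul.hSMul (Pi1 (MV.pt (lam c))) (PieceBiset f i MU MV MW hρ hl c) _ _ g₂ t₂ := e
    -- The congruence is the identity here, so `g₁ · t₁ = g₂ · t₂` is solved by `k = g₁⁻¹ g₂`.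
    obtain ⟨k, hk⟩ := (hl.actHom_bijective MV (up c d₁ h₁)).2
      ((show Pi1 (MV.pt (lam c)) from g₁)⁻¹ * (show Pi1 (MV.pt (lam c)) from g₂))
    have ht : (show PieceBiset f i MU MV MW hρ hl c from t₁)
        = (show Pi1 (MV.pt (lam c)) from hl.actHom MV (up c d₁ h₁) k) •
          (show PieceBiset f i MU MV MW hρ hl c from t₂) := by
      rw [hk, mul_smul]
      exact eq_inv_smul_iff.2 e
    rw [← hl.actHom_minus_up] at hk
    exact congrArg (Sigma.mk _) (GraphOfBisets.mk_eq_mk_of_smul_eq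
      (corrGraphOfBisets f i MU MV MW hρ hl) ho₁ k ht (eq_inv_mul_iff_mul_eq.1 hk))
  · intro t
    have hzb : z ∈ f ⁻¹' U b := hab.subset (hρ.mapsTo c hz)
    obtain ⟨d, rfl, hd⟩ := hpull.2 b z hzb
    have hsub : W c ⊆ W d := by
      rw [hd, hpull.eq_pathComponentIn c z hz]
      exact pathComponentIn_mono (preimage_mono hab.subset)
    have hne : W c ≠ W d := by
      intro h
      obtain rfl := hW.injective h
      exact ssubset_irrefl _ hab
    have h : W c ⊂ W d := hsub.ssubset_of_ne hne
    refine ⟨⟨⟨up c d h, upObj_of_ssubset _ _ hab, rfl⟩,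
      Tensor.mk (ViaHom.mk _ (1 : Pi1 (MV.pt (lam c)))) t⟩, ?_⟩
    exact one_smul (Pi1 (MV.pt (lam c))) (show PieceBiset f i MU MV MW hρ hl c from t)

theorem isLeftFibrant_corrGraphOfBisets (hV : IsFiniteOneDimCover V) (hW : IsFiniteOneDimCover W)
    (hpull : IsPullbackCover f U W ρ) (hq : HasSquareLifting f) :
    (corrGraphOfBisets f i MU MV MW hρ hl).IsLeftFibrant := by
  refine ⟨isSimplicial_gHom f MU hρ hW hpull, ?_⟩
  rintro _ ⟨c, rfl⟩ x hx ho
  cases x with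
  | vert a => exact absurd ⟨a, rfl⟩ hx
  | up a b hab =>
    cases ho
    exact unionMap_up_bijective f i MU MV MW hρ hl hW hpull c b hab
  | down a b hab =>
    cases ho
    exact unionMap_down_bijective f i MU MV MW hρ hl hV hW hpull hq c a hab

/-- A set with a free action is a disjoint union of regular orbits. -/
theorem leftFree_of_smul_eq {H : Type u} {B : Type v} [Group H] [MulAction H B]
    (hfree : ∀ (h : H) (b : B), h • b = b → h = 1) : LeftFree H B := by
  have hcancel : ∀ (g g' : H) (b : B), g • b = g' • b → g = g' := fun g g' b e =>
    (inv_mul_eq_one.1 (hfree _ b (by rw [mul_smul, e, inv_smul_smul]))).symm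
  have hrep : ∀ b : B, ∃ h : H, h • (Quotient.mk (MulAction.orbitRel H B) b).out = b := fun b =>
    MulAction.orbitRel_apply.1 (Setoid.symm' _ (Quotient.mk_out (s := MulAction.orbitRel H B) b))
  -- The element `h b` carries the chosen representative of the orbit to `b`; by freeness it is
  -- unique and serves as the first coordinate.
  choose h hh using hrep
  refine ⟨Quotient (MulAction.orbitRel H B),
    ⟨fun b => (h b, Quotient.mk _ b), fun p => p.1 • p.2.out, hh, ?_⟩, ?_⟩
  · rintro ⟨g, s⟩
    have hs : Quotient.mk (MulAction.orbitRel H B) (g • s.out) = s := by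
      conv_rhs => rw [← s.out_eq]
      exact Quotient.sound (MulAction.orbitRel_apply.2 ⟨g, rfl⟩)
    have e := hh (g • s.out)
    rw [hs] at e
    exact Prod.ext (hcancel _ _ _ e) hs
  · intro g b
    have hs : Quotient.mk (MulAction.orbitRel H B) (g • b) = Quotient.mk _ b :=
      Quotient.sound (MulAction.orbitRel_apply.2 ⟨g, rfl⟩)
    have e := hh (g • b)
    rw [hs] at e
    refine Prod.ext (hcancel _ _ (Quotient.mk (MulAction.orbitRel H B) b).out ?_) hs
    exact e.trans ((congrArg (g • ·) (hh b)).symm.trans (mul_smul _ _ _).symm)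

/-- If `h` fixes `β̌ ⊗ γ`, some loop `δ` fixes `γ` and relates `β · h⁻¹` to `β`. Injectivity of the
covering on `π₁` kills `δ`, and then `β · h⁻¹ = β` forces `h = 1`. -/
theorem leftFree_corrGraphOfBisets (hpull : IsPullbackCover f U W ρ) (hf : IsCoveringMap f)
    (x : (coverGraph W).Obj) :
    LeftFree (MV.graphOfGroups.G ((hl.gHom MV).toFun x)) (ObjBiset f i MU MV MW hρ hl x) := by
  refine leftFree_of_smul_eq fun h t e => ?_
  apply (hl.actHom_bijective MV x).1
  rw [map_one]
  induction t using Tensor.ind with | h β γ => ?_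
  obtain ⟨δ, h₁, h₂⟩ := Tensor.mk_eq_mk (K := Pi1 (MW.pt (base x)))
    (b := (hl.actHom MV x h) • β) (b' := β) (c := γ) (c' := γ) e
  obtain rfl := eq_one_of_smul_eq hf (hρ.mapsTo (base x)) (hpull.eq_pathComponentIn (base x)) δ γ
    h₂.symm
  rw [MulOpposite.op_one, one_smul] at h₁
  have h₃ := MapBiset.op_smul_left_injective β.val (g := 1) (g' := (hl.actHom MV x h)⁻¹)
    ((one_smul _ _).trans h₁)
  exact inv_eq_one.1 h₃.symm

end PullbackCorrespondence

end BisetGraphs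

theorem proposition4p12 {X : Type u} {Y : Type v} {Z : Type w}
    [TopologicalSpace X] [TopologicalSpace Y] [TopologicalSpace Z]
    [PathConnectedSpace X] [PathConnectedSpace Y]
    (f : C(Z, X)) (i : C(Z, Y))
    {J : Type u₁} {L : Type u₂} {K : Type u₃}
    {U : J → Set X} {V : L → Set Y} {W : K → Set Z}
    (hU : BisetGraphs.IsFiniteOneDimCover U) (hV : BisetGraphs.IsFiniteOneDimCover V)
    (hW : BisetGraphs.IsFiniteOneDimCover W)
    (MU : BisetGraphs.Marking U) (MV : BisetGraphs.Marking V) (MW : BisetGraphs.Marking W)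
    {ρ : K → J} {lam : K → L}
    (hρ : BisetGraphs.Compatible f W U ρ) (hlam : BisetGraphs.Compatible i W V lam)
    (hpull : BisetGraphs.IsPullbackCover f U W ρ) :
    (BisetGraphs.IsFibration f →
      (BisetGraphs.corrGraphOfBisets f i MU MV MW hρ hlam).IsLeftFibrant) ∧
    (IsCoveringMap f →
      (BisetGraphs.corrGraphOfBisets f i MU MV MW hρ hlam).IsLeftFree) := by
  refine ⟨fun hf => ?_, fun hf => ⟨?_, ?_⟩⟩
  · exact BisetGraphs.isLeftFibrant_corrGraphOfBisets f i MU MV MW hρ hlam hV hW hpull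
      hf.hasSquareLifting
  · exact BisetGraphs.isLeftFibrant_corrGraphOfBisets f i MU MV MW hρ hlam hV hW hpull
      (BisetGraphs.isFibration_of_isCoveringMap hf).hasSquareLifting
  · exact BisetGraphs.leftFree_corrGraphOfBisets f i MU MV MW hρ hlam hpull hf
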